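/- Setting. Let $\mathcal X$ be a measurable state space and $\mathcal A$ a finite nonempty action set. Let $(X,Y)\sim\mathcal D$ on $\mathcal X\times\mathbb R^{\mathcal A}$, with mean reward $f(x,a)=\mathbb E[Y(a)\mid X=x]\in[-1,1]$. For a random variable $Z$ put $\|Z\|_{\psi_2}=\sup_{p\in\mathbb N,\,p\ge 1}p^{-1/2}(\mathbb E|Z|^p)^{1/p}$, and for a random vector $\|Z\|_{\psi_2}=\sup_{\|v\|\le 1}\|v^\top Z\|_{\psi_2}$. Assume that, conditionally on $X$, the noise $\eta(a)=Y(a)-f(X,a)$ satisfies $\|\eta(a)\|_{\psi_2}\le 1$ for every $a$. Let $\mu(\cdot\mid x)$ be a behavior policy with finite concentrability coefficient $\mathcal C(\mu)=\sup_{\pi,x,a}\pi(a\mid x)/\mu(a\mid x)$ (supremum over all stochastic policies, states and actions). The dataset $D=\{(x_i,a_i,y_i)\}_{i\in[n]}$, $n\ge1$, is i.i.d.: $(x_i,\bar y_i)\sim\mathcal D$, $a_i\sim\mu(\cdot\mid x_i)$ independently of $\bar y_i$ given $x_i$, and $y_i=\bar y_i(a_i)$. Write $\mathbb E_\mu$ for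 expectation over $X$ and $A\sim\mu(\cdot\mid X)$, $\mathbb E_X$ for expectation over $X$ alone, and $\mathrm{Reg}(\pi,\pi')=\mathbb E_X[f(X,\pi(X))-f(X,\pi'(X))]$ for deterministic policies $\pi,\pi':\mathcal X\to\mathcal A$. Also $\|x\|_S=\sqrt{x^\top Sx}$, and $\|S\|$ is the spectral norm of a matrix $S$. Model classes. For $k\in[M]$, $M\ge1$, let $\mathcal F_k=\{(x,a)\mapsto\langle\phi_k(x,a),\theta\rangle:\theta\in\mathbb R^{d_k}\}$ with known feature maps $\phi_k:\mathcal X\times\mathcal A\to\mathbb R^{d_k}$, $d_k\ge 1$, that are nested: the first $d_k$ coordinates of $\phi_{k+1}$ are $\phi_k$. Assume for every $k$ that $\mathbb E_\mu[\phi_k(X,A)]=0$, that $\Sigma_k=\mathbb E_\mu[\phi_k(X,A)\phi_k(X,A)^\top]\succ0$, that $\|\Sigma_k^{-1/2}\phi_k(X,A)\|_{\psi_2}\le1$ under the law of $(X,A)$, $A\sim\mu(\cdot\mid X)$, and that the minimizer $\bar\theta_k$ of $\theta\mapsto\mathbb E_\mu(\langle\phi_k(X,A),\theta\rangle-f(X,A))^2$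 satisfies $\|\bar\theta_k\|\le1$. Let $$\tilde\epsilon_k=\min_{\theta\in\mathbb R^{d_k}}2\sqrt{\mathcal C(\mu)\,\mathbb E_\mu(\langle\phi_k(X,A),\theta\rangle-f(X,A))^2}.$$ Method. With regularization $\lambda_k=\lambda=1$, let $V_k=\frac{\lambda}{n}I+\frac1n\sum_i\phi_k(x_i,a_i)\phi_k(x_i,a_i)^\top$, $\hat\theta_k=V_k^{-1}\big(\frac1n\sum_i\phi_k(x_i,a_i)y_i\big)$, $\hat f_k=\langle\phi_k,\hat\theta_k\rangle$, $\hat\pi_k(x)\in\arg\max_a\hat f_k(x,a)$, $$\zeta_k(\delta)=\sqrt{\tfrac{\lambda d_k}{n}}+C_1\sqrt{\tfrac{d_k}{n}}\,\|V_k^{-1/2}\|\log\tfrac{4d_k}{\delta}+\sqrt{\tfrac{C_2d_k+C_3d_k^{1/2}\log^{1/2}(4d_k/\delta)+C_4\log(4d_k/\delta)}{n}},$$ and $\xi_k=\zeta_k(\delta/M)\,\mathbb E_X\max_a\|\phi_k(X,a)\|_{V_k^{-1}}$. For $k,\ell\in[M]$ let $\hat v_k(\hat\pi_\ell)=\mathbb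 E_X\hat f_k(X,\hat\pi_\ell(X))$ and $\mathcal I_{k,\ell}=[\hat v_k(\hat\pi_\ell)-2\xi_k,\ \hat v_k(\hat\pi_\ell)+2\xi_k]$ (with $D$ fixed in $\mathbb E_X$), $\hat k(\ell)=\min\{k:\bigcap_{j=k}^M\mathcal I_{j,\ell}\ne\emptyset\}$, and $\hat v(\hat\pi_\ell)=\hat v_{\hat k(\ell)}(\hat\pi_\ell)$. The method outputs $\hat\pi=\hat\pi_{\hat k}$ with $\hat k\in\arg\max_{k\in[M]}\hat v(\hat\pi_k)$, ties being broken arbitrarily throughout. Theorem. There is an absolute constant $C_0>0$ such that, for all $C_1,C_2,C_3,C_4\ge C_0$, in every setting as above and for every $0<\delta\le1/e$, the method outputs a policy (on every dataset), and with probability at least $1-4\delta$ over $D$, for every way of breaking ties and simultaneously for every deterministic comparator policy $\pi$, $$\mathrm{Reg}(\pi,\hat\pi)\le12\min_{k\in[M]}\Big\{\tilde\epsilon_k+\zeta_k(\delta/M)\cdot\mathbb E_X\max_a\|\phi_k(X,a)\|_{V_k^{-1}}\Big\}.$$ -/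

import Mathlib

open MeasureTheory ProbabilityTheory
open scoped ENNReal Matrix

namespace BatchBandit

noncomputable section

/-! ### Norms -/

/-- The sub-Gaussian norm `sup_{p ≥ 1} p^{-1/2} (E |Z|^p)^{1/p}` of a real random variable,
with values in `[0, ∞]`. -/
def psi2Norm {Ω : Type*} [MeasurableSpace Ω] (P : Measure Ω) (Z : Ω → ℝ) : ℝ≥0∞ :=
  ⨆ p : {p : ℕ // 1 ≤ p},
    ENNReal.ofReal (√((p : ℕ) : ℝ))⁻¹ * eLpNorm Z ((p : ℕ) : ℝ≥0∞) P

/-- The sub-Gaussian norm `sup_{‖v‖ ≤ 1} ‖⟨v, Z⟩‖_{ψ₂}` of a random vector. -/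
def psi2NormVec {Ω : Type*} [MeasurableSpace Ω] {d : ℕ} (P : Measure Ω)
    (Z : Ω → EuclideanSpace ℝ (Fin d)) : ℝ≥0∞ :=
  ⨆ v : {v : EuclideanSpace ℝ (Fin d) // ‖v‖ ≤ 1},
    psi2Norm P (fun ω => inner ℝ (v : EuclideanSpace ℝ (Fin d)) (Z ω))

/-- `S^{-1/2}` for a symmetric positive definite matrix `S`, by functional calculus. -/
def invSqrt {d : ℕ} (S : Matrix (Fin d) (Fin d) ℝ) : Matrix (Fin d) (Fin d) ℝ :=
  cfc (fun t : ℝ => (√t)⁻¹) S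

/-- The spectral norm of a square matrix. -/
def specNorm {d : ℕ} (S : Matrix (Fin d) (Fin d) ℝ) : ℝ :=
  ‖Matrix.toEuclideanCLM (n := Fin d) (𝕜 := ℝ) S‖

/-- The Mahalanobis norm `‖x‖_S = √(xᵀ S x)`. -/
def mahalanobis {d : ℕ} (S : Matrix (Fin d) (Fin d) ℝ) (x : EuclideanSpace ℝ (Fin d)) : ℝ :=
  √(x.ofLp ⬝ᵥ (S *ᵥ x.ofLp))

/-! ### Contextual bandits -/

/-- A contextual bandit: a joint law of `(X, Y)` on `𝒳 × ℝ^𝒜`, given by the law of the state `X`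
and the conditional law of the reward vector `Y` given `X`. -/
structure Bandit (𝒳 𝒜 : Type*) [MeasurableSpace 𝒳] where
  /-- the law of the state -/
  stateLaw : Measure 𝒳
  /-- the conditional law of the reward vector given the state -/
  rewardLaw : Kernel 𝒳 (𝒜 → ℝ)
  isProb : IsProbabilityMeasure stateLaw
  isMarkov : IsMarkovKernel rewardLaw

attribute [instance] Bandit.isProb Bandit.isMarkov

/-- Deterministic policies. -/
abbrev Policy (𝒳 𝒜 : Type*) [MeasurableSpace 𝒳] [MeasurableSpace 𝒜] : Type _ :=
  {π : 𝒳 → 𝒜 // Measurable π}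

/-- A dataset of `n` triples (state, action, observed reward). -/
abbrev Dataset (𝒳 𝒜 : Type*) (n : ℕ) : Type _ := Fin n → 𝒳 × 𝒜 × ℝ

section Setting

variable {𝒳 𝒜 : Type*} [MeasurableSpace 𝒳] [MeasurableSpace 𝒜]

/-- The expected reward `f(x, a) = E[Y(a) | x]`. -/
def Bandit.meanReward (B : Bandit 𝒳 𝒜) (x : 𝒳) (a : 𝒜) : ℝ :=
  ∫ y, y a ∂(B.rewardLaw x)

/-- `f(X, a) ∈ [-1, 1]`, and conditionally on the state the noise `η(a) = Y(a) - f(X, a)` is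
sub-Gaussian with norm at most `1`. -/
def Bandit.Regular (B : Bandit 𝒳 𝒜) : Prop :=
  ∀ᵐ x ∂B.stateLaw, ∀ a : 𝒜,
    B.meanReward x a ∈ Set.Icc (-1 : ℝ) 1 ∧
    psi2Norm (B.rewardLaw x) (fun y => y a - B.meanReward x a) ≤ 1

/-- `Reg(π, π') = E_X [f(X, π(X)) - f(X, π'(X))]`. -/
def Bandit.regret (B : Bandit 𝒳 𝒜) (π π' : Policy 𝒳 𝒜) : ℝ :=
  ∫ x, (B.meanReward x (π.1 x) - B.meanReward x (π'.1 x)) ∂B.stateLaw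

/-- The joint law of `(X, A)` when `A ~ μ(· | X)`; expectations under it are written `E_μ`. -/
def Bandit.stateAction (B : Bandit 𝒳 𝒜) (μ : Kernel 𝒳 𝒜) : Measure (𝒳 × 𝒜) :=
  B.stateLaw ⊗ₘ μ

/-- The law of one interaction `(x, a, y)`: `(x, ȳ)` is drawn from the bandit, `a ~ μ(· | x)`
independently of `ȳ` given `x`, and only `y = ȳ(a)` is recorded. -/
def Bandit.sampleLaw (B : Bandit 𝒳 𝒜) (μ : Kernel 𝒳 𝒜) : Measure (𝒳 × 𝒜 × ℝ) :=
  (B.stateLaw ⊗ₘ (μ ×ₖ B.rewardLaw)).map (fun z => (z.1, z.2.1, z.2.2 z.2.1))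

/-- The law of a dataset of `n` i.i.d. interactions. -/
def Bandit.dataLaw (B : Bandit 𝒳 𝒜) (μ : Kernel 𝒳 𝒜) (n : ℕ) : Measure (Dataset 𝒳 𝒜 n) :=
  Measure.pi (fun _ => B.sampleLaw μ)

/-- The concentrability coefficient `C(μ) = sup_{π, x, a} π(a | x) / μ(a | x)`, the supremum being
over all stochastic policies `π`, all states and all actions. -/
def concentrability (μ : Kernel 𝒳 𝒜) : ℝ≥0∞ :=
  ⨆ (π : {π : Kernel 𝒳 𝒜 // IsMarkovKernel π}) (x : 𝒳) (a : 𝒜), π.1 x {a} / μ x {a}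

/-! ### A single linear model class with feature map `φ` -/

variable {d : ℕ}

/-- The feature map as a function of the pair (state, action). -/
def featurePair (φ : 𝒳 → 𝒜 → EuclideanSpace ℝ (Fin d)) (z : 𝒳 × 𝒜) :
    EuclideanSpace ℝ (Fin d) := φ z.1 z.2

/-- `Σ = E_μ [φ(X, A) φ(X, A)ᵀ]`. -/
def Bandit.featureCov (B : Bandit 𝒳 𝒜) (μ : Kernel 𝒳 𝒜)
    (φ : 𝒳 → 𝒜 → EuclideanSpace ℝ (Fin d)) : Matrix (Fin d) (Fin d) ℝ :=
  Matrix.of fun i j => ∫ z, featurePair φ z i * featurePair φ z j ∂(B.stateAction μ)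

/-- Centred features, positive definite second moment matrix, and whitened features of
sub-Gaussian norm at most `1`. -/
def Bandit.WellConditioned (B : Bandit 𝒳 𝒜) (μ : Kernel 𝒳 𝒜)
    (φ : 𝒳 → 𝒜 → EuclideanSpace ℝ (Fin d)) : Prop :=
  ∫ z, featurePair φ z ∂(B.stateAction μ) = 0 ∧
  (B.featureCov μ φ).PosDef ∧
  psi2NormVec (B.stateAction μ)
    (fun z => WithLp.toLp 2 (invSqrt (B.featureCov μ φ) *ᵥ (featurePair φ z).ofLp)) ≤ 1

/-- `E_μ (⟨φ(X, A), θ⟩ - f(X, A))²`. -/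
def Bandit.meanSqError (B : Bandit 𝒳 𝒜) (μ : Kernel 𝒳 𝒜)
    (φ : 𝒳 → 𝒜 → EuclideanSpace ℝ (Fin d)) (θ : EuclideanSpace ℝ (Fin d)) : ℝ :=
  ∫ z, (inner ℝ (featurePair φ z) θ - B.meanReward z.1 z.2) ^ 2 ∂(B.stateAction μ)

/-- The minimiser `θ̄` of the mean squared error (unique when `Σ` is positive definite) has
Euclidean norm at most `1`. -/
def Bandit.BoundedNorm (B : Bandit 𝒳 𝒜) (μ : Kernel 𝒳 𝒜)
    (φ : 𝒳 → 𝒜 → EuclideanSpace ℝ (Fin d)) : Prop :=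
  ∀ θbar : EuclideanSpace ℝ (Fin d),
    (∀ θ, B.meanSqError μ φ θbar ≤ B.meanSqError μ φ θ) → ‖θbar‖ ≤ 1

/-- `ε̃ = min_θ 2 √(C(μ) E_μ (⟨φ(X, A), θ⟩ - f(X, A))²)`. -/
def Bandit.approxError (B : Bandit 𝒳 𝒜) (μ : Kernel 𝒳 𝒜)
    (φ : 𝒳 → 𝒜 → EuclideanSpace ℝ (Fin d)) : ℝ :=
  ⨅ θ : EuclideanSpace ℝ (Fin d),
    2 * √((concentrability μ).toReal * B.meanSqError μ φ θ)

variable {n : ℕ}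

/-- `V = (λ/n) I + (1/n) ∑ᵢ φ(xᵢ, aᵢ) φ(xᵢ, aᵢ)ᵀ`. -/
def empCov (lam : ℝ) (φ : 𝒳 → 𝒜 → EuclideanSpace ℝ (Fin d)) (D : Dataset 𝒳 𝒜 n) :
    Matrix (Fin d) (Fin d) ℝ :=
  (lam / (n : ℝ)) • (1 : Matrix (Fin d) (Fin d) ℝ) +
    (1 / (n : ℝ)) • ∑ i, Matrix.vecMulVec (φ (D i).1 (D i).2.1).ofLp (φ (D i).1 (D i).2.1).ofLp

/-- The ridge estimate `θ̂ = V⁻¹ ((1/n) ∑ᵢ φ(xᵢ, aᵢ) yᵢ)`. -/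
def ridge (lam : ℝ) (φ : 𝒳 → 𝒜 → EuclideanSpace ℝ (Fin d)) (D : Dataset 𝒳 𝒜 n) :
    EuclideanSpace ℝ (Fin d) :=
  WithLp.toLp 2 ((empCov lam φ D)⁻¹ *ᵥ
    ((1 / (n : ℝ)) • ∑ i, (D i).2.2 • (φ (D i).1 (D i).2.1).ofLp))

/-- The fitted value function `f̂(x, a) = ⟨φ(x, a), θ̂⟩`. -/
def fitted (lam : ℝ) (φ : 𝒳 → 𝒜 → EuclideanSpace ℝ (Fin d)) (D : Dataset 𝒳 𝒜 n)
    (x : 𝒳) (a : 𝒜) : ℝ :=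
  inner ℝ (φ x a) (ridge lam φ D)

/-- The estimated value `v̂(π) = E_X [f̂(X, π(X))]`. -/
def Bandit.valueEst (B : Bandit 𝒳 𝒜) (lam : ℝ) (φ : 𝒳 → 𝒜 → EuclideanSpace ℝ (Fin d))
    (D : Dataset 𝒳 𝒜 n) (π : Policy 𝒳 𝒜) : ℝ :=
  ∫ x, fitted lam φ D x (π.1 x) ∂B.stateLaw

/-- The coverage factor `E_X max_a ‖φ(X, a)‖_{V⁻¹}`. -/
def Bandit.coverage (B : Bandit 𝒳 𝒜) (lam : ℝ) (φ : 𝒳 → 𝒜 → EuclideanSpace ℝ (Fin d))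
    (D : Dataset 𝒳 𝒜 n) : ℝ :=
  ∫ x, (⨆ a : 𝒜, mahalanobis (empCov lam φ D)⁻¹ (φ x a)) ∂B.stateLaw

/-- The complexity coefficient `ζ(δ)`, for the constants `C₁, C₂, C₃, C₄`. -/
def zeta (C₁ C₂ C₃ C₄ lam : ℝ) (φ : 𝒳 → 𝒜 → EuclideanSpace ℝ (Fin d)) (D : Dataset 𝒳 𝒜 n)
    (δ : ℝ) : ℝ :=
  √(lam * d / n) +
    C₁ * √(d / n) * specNorm (invSqrt (empCov lam φ D)) * Real.log (4 * d / δ) +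
    √((C₂ * d + C₃ * √d * √(Real.log (4 * d / δ)) + C₄ * Real.log (4 * d / δ)) / n)

end Setting

/-! ### Collections of linear model classes and the selection method -/

/-- A collection of `M` linear model classes, given by feature maps `φ₁, …, φ_M` of dimensions
`d₁, …, d_M`. -/
structure ModelClasses (𝒳 𝒜 : Type*) (M : ℕ) where
  /-- the dimensions -/
  dim : Fin M → ℕ
  /-- the feature maps -/
  feature : (k : Fin M) → 𝒳 → 𝒜 → EuclideanSpace ℝ (Fin (dim k))

/-- Nestedness: the first `d_k` coordinates of `φ_{k+1}` are those of `φ_k`. -/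
def ModelClasses.Nested {𝒳 𝒜 : Type*} {M : ℕ} (F : ModelClasses 𝒳 𝒜 M) : Prop :=
  ∀ k l : Fin M, l.val = k.val + 1 →
    ∃ h : F.dim k ≤ F.dim l, ∀ (x : 𝒳) (a : 𝒜) (i : Fin (F.dim k)),
      F.feature l x a (Fin.castLE h i) = F.feature k x a i

section Selection

variable {𝒳 𝒜 : Type*} [MeasurableSpace 𝒳] [MeasurableSpace 𝒜] {M n : ℕ}

/-- The half-width unit `ξ_k = ζ_k(δ/M) · E_X max_a ‖φ_k(X, a)‖_{V_k⁻¹}`. -/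
def Bandit.xi (B : Bandit 𝒳 𝒜) (F : ModelClasses 𝒳 𝒜 M) (C₁ C₂ C₃ C₄ lam δ : ℝ)
    (D : Dataset 𝒳 𝒜 n) (k : Fin M) : ℝ :=
  zeta C₁ C₂ C₃ C₄ lam (F.feature k) D (δ / M) * B.coverage lam (F.feature k) D

/-- The interval `[v̂_k(π) - 2 ξ_k, v̂_k(π) + 2 ξ_k]`. -/
def Bandit.interval (B : Bandit 𝒳 𝒜) (F : ModelClasses 𝒳 𝒜 M) (C₁ C₂ C₃ C₄ lam δ : ℝ)
    (D : Dataset 𝒳 𝒜 n) (π : Policy 𝒳 𝒜) (k : Fin M) : Set ℝ :=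
  Set.Icc (B.valueEst lam (F.feature k) D π - 2 * B.xi F C₁ C₂ C₃ C₄ lam δ D k)
    (B.valueEst lam (F.feature k) D π + 2 * B.xi F C₁ C₂ C₃ C₄ lam δ D k)

/-- `πhat` is a possible output of the selection method on the dataset `D`, for some way of
breaking ties: `greedy k` is an argmax policy for the `k`-th fitted value function, `sel l` is the
least `k` such that the intervals with indices `k, …, M` for the policy `greedy l` have a common
point, and `πhat` is the greedy policy of largest selected value estimate. -/
def Bandit.IsSlopeOutput (B : Bandit 𝒳 𝒜) (F : ModelClasses 𝒳 𝒜 M) (C₁ C₂ C₃ C₄ lam δ : ℝ)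
    (D : Dataset 𝒳 𝒜 n) (πhat : Policy 𝒳 𝒜) : Prop :=
  ∃ (greedy : Fin M → Policy 𝒳 𝒜) (sel : Fin M → Fin M) (khat : Fin M),
    (∀ k x a, fitted lam (F.feature k) D x a ≤ fitted lam (F.feature k) D x ((greedy k).1 x)) ∧
    (∀ l, IsLeast {k : Fin M |
      (⋂ j ∈ Set.Ici k, B.interval F C₁ C₂ C₃ C₄ lam δ D (greedy l) j).Nonempty} (sel l)) ∧
    (∀ l, B.valueEst lam (F.feature (sel l)) D (greedy l) ≤
      B.valueEst lam (F.feature (sel khat)) D (greedy khat)) ∧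
    πhat = greedy khat

end Selection

end

end BatchBandit

open BatchBandit

/-!
Fix a class `k` and write `r = y - ⟨φ(x, a), θ̄⟩` for the residual of a recorded reward at the best
linear fit. It contains both the noise and the misspecification, it is uncorrelated with the
features by the normal equations, and it is sub-Gaussian, being the sum of the noise, the bounded
mean reward and `⟨φ, θ̄⟩`, whose `L²` norm is at most that of `f`. For such residuals the
self-normalised inequality `(∑ ⟨φᵢ, w⟩ rᵢ)² ≤ K (d + L) ∑ ⟨φᵢ, w⟩²` holds for all `w` at once
with probability `1 - 4 exp (-L)` (`measure_pi_not_selfNormalised_le`). When `n` is large compared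
with `d + L` this follows from Bernstein's inequality on a finite net of the unit ball, applied to the
whitened features; for smaller `n` it follows from Cauchy–Schwarz and a crude bound on `∑ rᵢ²`.

The basic inequality for ridge regression (`sqrt_ridge_error_le`) turns this into
`‖θ̂ - θ̄‖_V ≤ √(1 / n) + √(K (d + L) / n)`, which for `L = log (4 d M / δ)` is at most `ζ(δ / M)`
(`sqrt_add_sqrt_le_zeta`). Noise and misspecification are treated together, so the `C₁` and `C₃`
terms of `ζ` only matter through their sign and their monotonicity in `k`. By duality and
concentrability all policies `π` satisfy
`|v̂ₖ(π) - v(π)| ≤ ξₖ + ε̃ₖ / 2` (`Bandit.abs_valueEst_sub_value_le`), simultaneously for all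
classes after a union bound.

Nestedness makes `ξₖ` increasing and `ε̃ₖ` decreasing in `k`. Under this monotonicity the interval
intersection rule estimates the value of each greedy policy up to `5 ξₖ + 3 ε̃ₖ / 2` for every `k`
(`abs_selected_sub_le`), and comparing the output with the `k`-th greedy policy, and that with `π`,
costs at most `12 ξₖ + 4 ε̃ₖ` (`Bandit.regret_le_of_isSlopeOutput`).
-/

namespace BatchBandit

-- Several sections fix the standing assumptions on the model once for all their lemmas.
set_option linter.unusedSectionVars false

/-! ### Exponential moments and Chernoff bounds -/

section Concentration

variable {Ω : Type*} [MeasurableSpace Ω] {P : Measure Ω}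

lemma lintegral_pow_le_of_psi2Norm_le_one {Z : Ω → ℝ} (h : psi2Norm P Z ≤ 1) {p : ℕ}
    (hp : 1 ≤ p) : ∫⁻ ω, ENNReal.ofReal (|Z ω| ^ p) ∂P ≤ ENNReal.ofReal (√p ^ p) := by
  have hp0 : (p : ℝ≥0∞) ≠ 0 := by simp; omega
  have hs : 0 < √(p : ℝ) := Real.sqrt_pos.2 (by exact_mod_cast hp)
  have h1 : ENNReal.ofReal (√(p : ℝ))⁻¹ * eLpNorm Z (p : ℝ≥0∞) P ≤ 1 :=
    (le_iSup (fun p : {p : ℕ // 1 ≤ p} =>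
      ENNReal.ofReal (√((p : ℕ) : ℝ))⁻¹ * eLpNorm Z ((p : ℕ) : ℝ≥0∞) P) ⟨p, hp⟩).trans h
  have h2 : eLpNorm Z (p : ℝ≥0∞) P ≤ ENNReal.ofReal (√(p : ℝ)) := by
    rw [ENNReal.ofReal_inv_of_pos hs] at h1
    rwa [mul_comm, ← div_eq_mul_inv, ENNReal.div_le_iff (by simpa using hs) (by simp),
      one_mul] at h1
  rw [eLpNorm_eq_lintegral_rpow_enorm_toReal hp0 (by simp)] at h2
  have h3 := ENNReal.rpow_le_rpow h2 (show (0:ℝ) ≤ p by positivity)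
  rw [← ENNReal.rpow_mul] at h3
  simp only [ENNReal.toReal_natCast] at h3
  rw [one_div_mul_cancel (by positivity), ENNReal.rpow_one, ENNReal.rpow_natCast,
    ← ENNReal.ofReal_pow hs.le] at h3
  refine le_trans (le_of_eq (lintegral_congr fun ω => ?_)) h3
  rw [ENNReal.rpow_natCast, Real.enorm_eq_ofReal_abs, ENNReal.ofReal_pow (abs_nonneg _)]

/-- A variable of sub-Gaussian norm at most `1` has square-exponential moments: expand
`exp (c Z²)` in a power series and use `p ^ p ≤ e ^ p p!`. -/
lemma lintegral_exp_sq_le_two [IsProbabilityMeasure P] {Z : Ω → ℝ} (hZ : Measurable Z)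
    (h : psi2Norm P Z ≤ 1) {c : ℝ} (hc0 : 0 ≤ c) (hc : c ≤ 1 / 16) :
    ∫⁻ ω, ENNReal.ofReal (Real.exp (c * Z ω ^ 2)) ∂P ≤ 2 := by
  have key : ∀ ω, ENNReal.ofReal (Real.exp (c * Z ω ^ 2)) =
      ∑' p : ℕ, ENNReal.ofReal (c ^ p / p.factorial) * ENNReal.ofReal (|Z ω| ^ (2 * p)) := by
    intro ω
    have hsum := NormedSpace.expSeries_div_hasSum_exp (𝔸 := ℝ) (c * Z ω ^ 2)
    rw [← Real.exp_eq_exp_ℝ] at hsum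
    rw [← hsum.tsum_eq, ENNReal.ofReal_tsum_of_nonneg (fun p => by positivity) hsum.summable]
    refine tsum_congr fun p => ?_
    rw [← ENNReal.ofReal_mul (by positivity), pow_mul, sq_abs, mul_pow]
    ring_nf
  simp_rw [key]
  rw [lintegral_tsum (fun p => by fun_prop)]
  have hterm : ∀ p : ℕ, ∫⁻ ω, ENNReal.ofReal (c ^ p / p.factorial) *
      ENNReal.ofReal (|Z ω| ^ (2 * p)) ∂P ≤ (2⁻¹ : ℝ≥0∞) ^ p := by
    intro p
    rw [lintegral_const_mul _ (by fun_prop)]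
    rcases Nat.eq_zero_or_pos p with rfl | hp
    · simp
    have h1 := lintegral_pow_le_of_psi2Norm_le_one h (p := 2 * p) (by omega)
    calc _ ≤ ENNReal.ofReal (c ^ p / p.factorial) *
          ENNReal.ofReal (√((2 * p : ℕ) : ℝ) ^ (2 * p)) := by gcongr
      _ = ENNReal.ofReal (c ^ p / p.factorial * √((2 * p : ℕ) : ℝ) ^ (2 * p)) :=
          (ENNReal.ofReal_mul (by positivity)).symm
      _ ≤ ENNReal.ofReal ((1 / 2) ^ p) := by
          refine ENNReal.ofReal_le_ofReal ?_
          rw [pow_mul, Real.sq_sqrt (by positivity)]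
          have hexp : (p : ℝ) ^ p / p.factorial ≤ Real.exp 1 ^ p := by
            rw [← Real.exp_nat_mul, mul_one]
            exact Real.pow_div_factorial_le_exp _ (by positivity) p
          calc c ^ p / p.factorial * ((2 * p : ℕ) : ℝ) ^ p
              = (c * 2) ^ p * ((p : ℝ) ^ p / p.factorial) := by
                push_cast; rw [mul_pow, mul_pow]; ring
            _ ≤ (c * 2) ^ p * Real.exp 1 ^ p := by gcongr
            _ = (c * 2 * Real.exp 1) ^ p := by rw [mul_pow _ (Real.exp 1)]
            _ ≤ (1 / 2) ^ p := by
                have := Real.exp_one_lt_d9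
                gcongr
                nlinarith [Real.exp_pos 1]
      _ = _ := by
          rw [ENNReal.ofReal_pow (by norm_num)]
          congr 1
          rw [one_div, ENNReal.ofReal_inv_of_pos two_pos, ENNReal.ofReal_ofNat]
  refine (ENNReal.tsum_le_tsum hterm).trans ?_
  rw [ENNReal.tsum_geometric, ENNReal.one_sub_inv_two, inv_inv]

lemma lintegral_pi_prod_eq_pow (P : Measure Ω) [IsProbabilityMeasure P] (n : ℕ) {g : Ω → ℝ≥0∞}
    (hg : Measurable g) :
    ∫⁻ D, ∏ i, g (D i) ∂Measure.pi (fun _ : Fin n => P) = (∫⁻ ω, g ω ∂P) ^ n := by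
  have hind : iIndepFun (fun (i : Fin n) (D : Fin n → Ω) => g (D i))
      (Measure.pi (fun _ : Fin n => P)) :=
    iIndepFun_pi (X := fun _ => g) (fun _ => hg.aemeasurable)
  rw [lintegral_prod_eq_prod_lintegral_of_indepFun Finset.univ _ hind (fun i => by fun_prop)]
  have : ∀ i : Fin n, ∫⁻ D, g (D i) ∂Measure.pi (fun _ : Fin n => P) = ∫⁻ ω, g ω ∂P := fun i =>
    (measurePreserving_eval (fun _ : Fin n => P) i).lintegral_comp hg
  simp [this]

/-- **Chernoff bound** for i.i.d. sums. -/
lemma measure_pi_sum_ge_le (P : Measure Ω) [IsProbabilityMeasure P] (n : ℕ) {h : Ω → ℝ}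
    (hh : Measurable h) {κ : ℝ}
    (hκ : ∫⁻ ω, ENNReal.ofReal (Real.exp (h ω)) ∂P ≤ ENNReal.ofReal (Real.exp κ)) (t : ℝ) :
    Measure.pi (fun _ : Fin n => P) {D | t ≤ ∑ i, h (D i)} ≤
      ENNReal.ofReal (Real.exp (n * κ - t)) := by
  set Q := Measure.pi (fun _ : Fin n => P)
  have hprod : ∀ D : Fin n → Ω, ENNReal.ofReal (Real.exp (∑ i, h (D i))) =
      ∏ i, ENNReal.ofReal (Real.exp (h (D i))) := by
    intro D
    rw [Real.exp_sum, ENNReal.ofReal_prod_of_nonneg (fun i _ => (Real.exp_pos _).le)]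
  have h1 := mul_meas_ge_le_lintegral (μ := Q)
    (f := fun D => ENNReal.ofReal (Real.exp (∑ i, h (D i)))) (by fun_prop)
    (ENNReal.ofReal (Real.exp t))
  simp_rw [hprod] at h1
  rw [lintegral_pi_prod_eq_pow P n (g := fun ω => ENNReal.ofReal (Real.exp (h ω)))
    (by fun_prop)] at h1
  have hset : {D : Fin n → Ω | t ≤ ∑ i, h (D i)} ⊆
      {D | ENNReal.ofReal (Real.exp t) ≤ ∏ i, ENNReal.ofReal (Real.exp (h (D i)))} := by
    intro D hD
    simp only [Set.mem_ofPred_eq] at hD ⊢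
    rw [← hprod]
    exact ENNReal.ofReal_le_ofReal (Real.exp_le_exp.2 hD)
  have h2 : ENNReal.ofReal (Real.exp t) * Q {D | t ≤ ∑ i, h (D i)} ≤
      ENNReal.ofReal (Real.exp κ) ^ n :=
    (mul_le_mul_right (measure_mono hset) _).trans (h1.trans (pow_le_pow_left' hκ n))
  rw [← ENNReal.ofReal_pow (Real.exp_pos _).le, ← Real.exp_nat_mul] at h2
  rw [Real.exp_sub, ENNReal.ofReal_div_of_pos (Real.exp_pos _),
    ENNReal.le_div_iff_mul_le (by simp [Real.exp_pos]) (by simp), mul_comm]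
  exact h2

lemma exp_le_one_add_add_sq_mul_exp_abs (x : ℝ) :
    Real.exp x ≤ 1 + x + x ^ 2 * Real.exp |x| := by
  have h1 : 1 ≤ Real.exp |x| := Real.one_le_exp (abs_nonneg x)
  rcases le_or_gt |x| 1 with hx | hx
  · have := (abs_le.1 (Real.abs_exp_sub_one_sub_id_le hx)).2
    nlinarith [sq_nonneg x]
  · rcases le_or_gt 0 x with h0 | h0
    · rw [abs_of_nonneg h0] at *
      nlinarith [mul_nonneg (Real.exp_pos x).le (by nlinarith : 0 ≤ x ^ 2 - 1)]
    · have h2 : Real.exp x ≤ 1 := Real.exp_le_one_iff.2 h0.le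
      rw [abs_of_neg h0] at *
      nlinarith [sq_nonneg x]

lemma integral_exp_le_of_lintegral {g : Ω → ℝ} (hg : Measurable g)
    (h : ∫⁻ ω, ENNReal.ofReal (Real.exp (g ω)) ∂P ≤ 2) :
    Integrable (fun ω => Real.exp (g ω)) P ∧ ∫ ω, Real.exp (g ω) ∂P ≤ 2 := by
  have hint : Integrable (fun ω => Real.exp (g ω)) P := by
    refine ⟨by fun_prop, ?_⟩
    rw [hasFiniteIntegral_iff_ofReal (ae_of_all _ fun _ => (Real.exp_pos _).le)]
    exact h.trans_lt (by simp)
  refine ⟨hint, ?_⟩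
  rw [← ofReal_integral_eq_lintegral_ofReal hint (ae_of_all _ fun _ => (Real.exp_pos _).le)] at h
  rwa [ENNReal.ofReal_le_iff_le_toReal (by simp)] at h

/-- Bernstein-type moment generating function bound for the product of two variables with
square-exponential moments. The remainder in `exp x ≤ 1 + x + x² exp |x|` is absorbed
by `2 |ξ₁ ξ₂| ≤ ξ₁² + ξ₂²`. -/
lemma lintegral_exp_mul_le [IsProbabilityMeasure P] {ξ₁ ξ₂ : Ω → ℝ} (h₁ : Measurable ξ₁)
    (h₂ : Measurable ξ₂) {c : ℝ} (hc : 0 < c)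
    (e₁ : ∫⁻ ω, ENNReal.ofReal (Real.exp (c * ξ₁ ω ^ 2)) ∂P ≤ 2)
    (e₂ : ∫⁻ ω, ENNReal.ofReal (Real.exp (c * ξ₂ ω ^ 2)) ∂P ≤ 2)
    {s : ℝ} (hs : |s| ≤ c / 2) :
    ∫⁻ ω, ENNReal.ofReal (Real.exp (s * (ξ₁ ω * ξ₂ ω))) ∂P ≤
      ENNReal.ofReal (Real.exp (s * (∫ ω, ξ₁ ω * ξ₂ ω ∂P) + 16 / c ^ 2 * s ^ 2)) := by
  obtain ⟨i₁, b₁⟩ := integral_exp_le_of_lintegral (by fun_prop) e₁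
  obtain ⟨i₂, b₂⟩ := integral_exp_le_of_lintegral (by fun_prop) e₂
  have hexp : ∀ ω, Real.exp (c * |ξ₁ ω * ξ₂ ω|) ≤
      (Real.exp (c * ξ₁ ω ^ 2) + Real.exp (c * ξ₂ ω ^ 2)) / 2 := by
    intro ω
    have h1 : |ξ₁ ω * ξ₂ ω| ≤ (ξ₁ ω ^ 2 + ξ₂ ω ^ 2) / 2 := by
      rw [abs_mul]
      nlinarith [sq_nonneg (|ξ₁ ω| - |ξ₂ ω|), sq_abs (ξ₁ ω), sq_abs (ξ₂ ω)]
    have h2 : Real.exp (c * |ξ₁ ω * ξ₂ ω|) ≤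
        Real.exp (c * ξ₁ ω ^ 2 / 2) * Real.exp (c * ξ₂ ω ^ 2 / 2) := by
      rw [← Real.exp_add, Real.exp_le_exp]
      nlinarith
    have h3 : ∀ y : ℝ, Real.exp (c * y ^ 2) = Real.exp (c * y ^ 2 / 2) ^ 2 := by
      intro y
      rw [← Real.exp_nat_mul]; congr 1; push_cast; ring
    rw [h3 (ξ₁ ω), h3 (ξ₂ ω)]
    nlinarith [sq_nonneg (Real.exp (c * ξ₁ ω ^ 2 / 2) - Real.exp (c * ξ₂ ω ^ 2 / 2))]
  have hW : Integrable (fun ω => ξ₁ ω * ξ₂ ω) P := by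
    refine Integrable.mono' (g := fun ω => 1 / c * ((Real.exp (c * ξ₁ ω ^ 2) +
      Real.exp (c * ξ₂ ω ^ 2)) / 2)) (((i₁.add i₂).div_const 2).const_mul _) (by fun_prop)
      (ae_of_all _ fun ω => ?_)
    rw [Real.norm_eq_abs, one_div, ← div_eq_inv_mul, le_div_iff₀ hc]
    have := Real.add_one_le_exp (c * |ξ₁ ω * ξ₂ ω|)
    linarith [hexp ω]
  have hpt : ∀ ω, Real.exp (s * (ξ₁ ω * ξ₂ ω)) ≤ 1 + s * (ξ₁ ω * ξ₂ ω) +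
      8 / c ^ 2 * s ^ 2 * ((Real.exp (c * ξ₁ ω ^ 2) + Real.exp (c * ξ₂ ω ^ 2)) / 2) := by
    intro ω
    set W := ξ₁ ω * ξ₂ ω
    have h1 := exp_le_one_add_add_sq_mul_exp_abs (s * W)
    have h2 : Real.exp |s * W| ≤ Real.exp (c / 2 * |W|) := by
      rw [Real.exp_le_exp, abs_mul]; gcongr
    have h3 : W ^ 2 ≤ 8 / c ^ 2 * Real.exp (c / 2 * |W|) := by
      have := Real.quadratic_le_exp_of_nonneg (x := c / 2 * |W|) (by positivity)
      rw [div_mul_eq_mul_div, le_div_iff₀ (by positivity)]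
      have hq : (c / 2 * |W|) ^ 2 = c ^ 2 / 4 * W ^ 2 := by rw [mul_pow, sq_abs]; ring
      have hn : 0 ≤ c / 2 * |W| := by positivity
      nlinarith
    have h4 : (s * W) ^ 2 * Real.exp |s * W| ≤ 8 / c ^ 2 * s ^ 2 * Real.exp (c * |W|) := by
      calc (s * W) ^ 2 * Real.exp |s * W| ≤ (s * W) ^ 2 * Real.exp (c / 2 * |W|) := by gcongr
        _ = s ^ 2 * (W ^ 2 * Real.exp (c / 2 * |W|)) := by ring
        _ ≤ s ^ 2 * (8 / c ^ 2 * Real.exp (c / 2 * |W|) * Real.exp (c / 2 * |W|)) := by gcongr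
        _ = 8 / c ^ 2 * s ^ 2 * (Real.exp (c / 2 * |W|) * Real.exp (c / 2 * |W|)) := by ring
        _ = _ := by rw [← Real.exp_add]; ring_nf
    have h5 : 8 / c ^ 2 * s ^ 2 * Real.exp (c * |W|) ≤ 8 / c ^ 2 * s ^ 2 *
        ((Real.exp (c * ξ₁ ω ^ 2) + Real.exp (c * ξ₂ ω ^ 2)) / 2) := by
      have := hexp ω
      gcongr
    linarith
  have hint : Integrable (fun ω => 1 + s * (ξ₁ ω * ξ₂ ω) +
      8 / c ^ 2 * s ^ 2 * ((Real.exp (c * ξ₁ ω ^ 2) + Real.exp (c * ξ₂ ω ^ 2)) / 2)) P :=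
    ((integrable_const 1).add (hW.const_mul s)).add (((i₁.add i₂).div_const 2).const_mul _)
  calc _ ≤ ∫⁻ ω, ENNReal.ofReal (1 + s * (ξ₁ ω * ξ₂ ω) +
      8 / c ^ 2 * s ^ 2 * ((Real.exp (c * ξ₁ ω ^ 2) + Real.exp (c * ξ₂ ω ^ 2)) / 2)) ∂P :=
        lintegral_mono fun ω => ENNReal.ofReal_le_ofReal (hpt ω)
    _ = ENNReal.ofReal (∫ ω, (1 + s * (ξ₁ ω * ξ₂ ω) +
      8 / c ^ 2 * s ^ 2 * ((Real.exp (c * ξ₁ ω ^ 2) + Real.exp (c * ξ₂ ω ^ 2)) / 2)) ∂P) :=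
        (ofReal_integral_eq_lintegral_ofReal hint (ae_of_all _ fun ω =>
          (Real.exp_pos _).le.trans (hpt ω))).symm
    _ ≤ _ := by
        refine ENNReal.ofReal_le_ofReal ?_
        have e : ∫ ω, (1 + s * (ξ₁ ω * ξ₂ ω) +
            8 / c ^ 2 * s ^ 2 * ((Real.exp (c * ξ₁ ω ^ 2) + Real.exp (c * ξ₂ ω ^ 2)) / 2)) ∂P =
            1 + s * (∫ ω, ξ₁ ω * ξ₂ ω ∂P) + 8 / c ^ 2 * s ^ 2 *
            ((∫ ω, Real.exp (c * ξ₁ ω ^ 2) ∂P + ∫ ω, Real.exp (c * ξ₂ ω ^ 2) ∂P) / 2) := by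
          have j₁ : Integrable (fun ω => s * (ξ₁ ω * ξ₂ ω)) P := hW.const_mul s
          have j₂ : Integrable (fun ω => 1 + s * (ξ₁ ω * ξ₂ ω)) P := (integrable_const 1).add j₁
          have j₃ : Integrable (fun ω => 8 / c ^ 2 * s ^ 2 *
              ((Real.exp (c * ξ₁ ω ^ 2) + Real.exp (c * ξ₂ ω ^ 2)) / 2)) P :=
            ((i₁.add i₂).div_const 2).const_mul _
          rw [integral_add j₂ j₃, integral_add (integrable_const 1) j₁, integral_const_mul,
            integral_const_mul, integral_div, integral_add i₁ i₂]
          simp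
        rw [e]
        have h6 : 8 / c ^ 2 * s ^ 2 * ((∫ ω, Real.exp (c * ξ₁ ω ^ 2) ∂P +
            ∫ ω, Real.exp (c * ξ₂ ω ^ 2) ∂P) / 2) ≤ 8 / c ^ 2 * s ^ 2 * 2 := by
          gcongr; linarith
        have h7 := Real.add_one_le_exp (s * (∫ ω, ξ₁ ω * ξ₂ ω ∂P) + 16 / c ^ 2 * s ^ 2)
        have h8 : 8 / c ^ 2 * s ^ 2 * 2 = 16 / c ^ 2 * s ^ 2 := by ring
        linarith

lemma measure_pi_mul_dev_ge_le [IsProbabilityMeasure P] (n : ℕ) {ξ₁ ξ₂ : Ω → ℝ}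
    (h₁ : Measurable ξ₁) (h₂ : Measurable ξ₂) {c : ℝ} (hc : 0 < c) (hc1 : c ≤ 1)
    (e₁ : ∫⁻ ω, ENNReal.ofReal (Real.exp (c * ξ₁ ω ^ 2)) ∂P ≤ 2)
    (e₂ : ∫⁻ ω, ENNReal.ofReal (Real.exp (c * ξ₂ ω ^ 2)) ∂P ≤ 2)
    {t : ℝ} (ht0 : 0 ≤ t) (ht1 : t ≤ 1) :
    Measure.pi (fun _ : Fin n => P)
      {D | n * ((∫ ω, ξ₁ ω * ξ₂ ω ∂P) + t) ≤ ∑ i, ξ₁ (D i) * ξ₂ (D i)} ≤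
      ENNReal.ofReal (Real.exp (-(n * t ^ 2 * c ^ 2 / 64))) := by
  rcases ht0.eq_or_lt with rfl | ht0
  · simpa using prob_le_one
  -- the optimal Chernoff parameter for the variance proxy `16 / c²`
  set s := t * c ^ 2 / 32 with hs
  have hs0 : 0 < s := by positivity
  have hsc : |s| ≤ c / 2 := by
    rw [abs_of_pos hs0, hs]
    have : t * c ≤ 1 := by nlinarith
    nlinarith
  have := measure_pi_sum_ge_le P n (h := fun ω => s * (ξ₁ ω * ξ₂ ω)) (by fun_prop)
    (lintegral_exp_mul_le h₁ h₂ hc e₁ e₂ hsc) (s * (n * ((∫ ω, ξ₁ ω * ξ₂ ω ∂P) + t)))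
  refine (measure_mono ?_).trans (this.trans (le_of_eq ?_))
  · intro D hD
    simp only [Set.mem_ofPred_eq] at hD ⊢
    rw [← Finset.mul_sum]
    exact mul_le_mul_of_nonneg_left hD hs0.le
  · congr 2
    rw [hs]; field_simp; ring

/-- Two-sided Bernstein inequality for empirical averages of a product. -/
lemma measure_pi_abs_mul_dev_ge_le [IsProbabilityMeasure P] (n : ℕ) {ξ₁ ξ₂ : Ω → ℝ}
    (h₁ : Measurable ξ₁) (h₂ : Measurable ξ₂) {c : ℝ} (hc : 0 < c) (hc1 : c ≤ 1)
    (e₁ : ∫⁻ ω, ENNReal.ofReal (Real.exp (c * ξ₁ ω ^ 2)) ∂P ≤ 2)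
    (e₂ : ∫⁻ ω, ENNReal.ofReal (Real.exp (c * ξ₂ ω ^ 2)) ∂P ≤ 2)
    {t : ℝ} (ht0 : 0 ≤ t) (ht1 : t ≤ 1) :
    Measure.pi (fun _ : Fin n => P)
      {D | n * t ≤ |∑ i, ξ₁ (D i) * ξ₂ (D i) - n * ∫ ω, ξ₁ ω * ξ₂ ω ∂P|} ≤
      2 * ENNReal.ofReal (Real.exp (-(n * t ^ 2 * c ^ 2 / 64))) := by
  have hp := measure_pi_mul_dev_ge_le (P := P) n h₁ h₂ hc hc1 e₁ e₂ ht0 ht1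
  have hm := measure_pi_mul_dev_ge_le (P := P) n h₁.neg h₂ hc hc1 (by simpa using e₁) e₂ ht0 ht1
  rw [two_mul]
  refine (measure_mono ?_).trans ((measure_union_le _ _).trans (add_le_add hp hm))
  intro D hD
  simp only [Set.mem_ofPred_eq, Set.mem_union, Pi.neg_apply, neg_mul, integral_neg,
    Finset.sum_neg_distrib] at hD ⊢
  rcases le_abs.1 hD with h | h
  · left; linarith
  · right; linarith

end Concentration

/-! ### Nets of the unit ball -/

section Net

variable {E : Type*} [NormedAddCommGroup E] [NormedSpace ℝ E]

/-- A finite set is a half-net if it lies in the unit ball and every point of the unit ball is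
within distance `1/2` of it. -/
def IsHalfNet (N : Finset E) : Prop :=
  (∀ v ∈ N, ‖v‖ ≤ 1) ∧ ∀ u : E, ‖u‖ ≤ 1 → ∃ v ∈ N, ‖u - v‖ ≤ 1 / 2

/-- Halving a maximal `1`-separated subset of the ball of radius `2` gives a half-net. -/
lemma exists_isHalfNet [FiniteDimensional ℝ E] :
    ∃ N : Finset E, IsHalfNet N ∧ N.card ≤ 5 ^ Module.finrank ℝ E := by
  classical
  let p : ℕ → Prop := fun m => ∃ s : Finset E, s.card = m ∧ (∀ c ∈ s, ‖c‖ ≤ 2) ∧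
    ∀ c ∈ s, ∀ d ∈ s, c ≠ d → 1 ≤ ‖c - d‖
  have hle : ∀ m, p m → m ≤ 5 ^ Module.finrank ℝ E := by
    rintro m ⟨s, rfl, h1, h2⟩
    exact Besicovitch.card_le_of_separated s h1 h2
  have h0 : p 0 := ⟨∅, by simp⟩
  obtain ⟨s, hcard, h1, h2⟩ := Nat.findGreatest_spec (P := p) (Nat.zero_le _) h0
  refine ⟨s.image (fun v => (1 / 2 : ℝ) • v), ⟨?_, ?_⟩, ?_⟩
  · intro v hv
    obtain ⟨w, hw, rfl⟩ := Finset.mem_image.1 hv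
    rw [norm_smul]
    norm_num
    linarith [h1 w hw]
  · intro u hu
    by_contra! hcon
    have hsep : ∀ w ∈ s, 1 ≤ ‖(2 : ℝ) • u - w‖ := by
      intro w hw
      have := hcon _ (Finset.mem_image_of_mem _ hw)
      have e : (2 : ℝ) • u - w = (2 : ℝ) • (u - (1 / 2 : ℝ) • w) := by
        rw [smul_sub, smul_smul]; norm_num
      rw [e, norm_smul]
      norm_num
      linarith
    have hnot : (2 : ℝ) • u ∉ s := by
      intro hmem
      have := hsep _ hmem
      simp at this
      linarith
    have hp : p (s.card + 1) := by
      refine ⟨insert ((2 : ℝ) • u) s, Finset.card_insert_of_notMem hnot, ?_, ?_⟩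
      · intro c hc
        rcases Finset.mem_insert.1 hc with rfl | hc
        · rw [norm_smul]; norm_num; linarith
        · exact h1 c hc
      · intro c hc e he hne
        rcases Finset.mem_insert.1 hc with hc' | hc' <;>
          rcases Finset.mem_insert.1 he with he' | he'
        · exact absurd (hc'.trans he'.symm) hne
        · rw [hc']; exact hsep e he'
        · rw [he', norm_sub_rev]; exact hsep c hc'
        · exact h2 c hc' e he' hne
    exact absurd ((Nat.le_findGreatest (hle _ hp) hp).trans hcard.ge) (Nat.not_succ_le_self _)
  · exact Finset.card_image_le.trans (hcard.le.trans (Nat.findGreatest_le _))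

lemma IsHalfNet.abs_map_le [FiniteDimensional ℝ E] {N : Finset E} (hN : IsHalfNet N)
    (l : E →ₗ[ℝ] ℝ) {t : ℝ} (ht : 0 ≤ t) (h : ∀ v ∈ N, |l v| ≤ t) (u : E) :
    |l u| ≤ 2 * t * ‖u‖ := by
  set l' : E →L[ℝ] ℝ := l.toContinuousLinearMap
  have hl : ∀ u, l u = l' u := fun _ => rfl
  have hb : ‖l'‖ ≤ t + ‖l'‖ / 2 := by
    refine l'.opNorm_le_of_unit_norm (by positivity) fun u hu => ?_
    obtain ⟨v, hv, huv⟩ := hN.2 u hu.le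
    have h1 : ‖l' u‖ ≤ ‖l' v‖ + ‖l' (u - v)‖ := by
      have : l' u = l' v + l' (u - v) := by simp
      rw [this]; exact norm_add_le _ _
    have h2 : ‖l' (u - v)‖ ≤ ‖l'‖ * (1 / 2) := (l'.le_opNorm _).trans (by gcongr)
    have h3 : ‖l' v‖ ≤ t := h v hv
    linarith
  have := l'.le_opNorm u
  rw [hl, ← Real.norm_eq_abs]
  exact this.trans (by gcongr; linarith)

end Net

/-! ### The self-normalised inequality for the design -/

section SelfNormalised

variable {Ω : Type*} [MeasurableSpace Ω]

lemma measure_biUnion_exp_le (Q : Measure Ω) {ι : Type*} (S : Finset ι) (A : ι → Set Ω) {m : ℕ}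
    (hS : S.card ≤ 5 ^ m) {L : ℝ}
    (hA : ∀ i ∈ S, Q (A i) ≤ 2 * ENNReal.ofReal (Real.exp (-(L + 2 * m)))) :
    Q (⋃ i ∈ S, A i) ≤ 2 * ENNReal.ofReal (Real.exp (-L)) := by
  have h5 : (5 : ℝ) ^ m ≤ Real.exp (2 * m) := by
    rw [mul_comm, Real.exp_nat_mul]
    have : (2 : ℝ) + 1 ≤ Real.exp 2 := Real.add_one_le_exp 2
    have h1 := Real.exp_one_gt_d9
    have h2 : Real.exp 2 = Real.exp 1 * Real.exp 1 := by rw [← Real.exp_add]; norm_num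
    gcongr
    nlinarith
  calc Q (⋃ i ∈ S, A i) ≤ ∑ i ∈ S, Q (A i) := measure_biUnion_finset_le _ _
    _ ≤ ∑ _i ∈ S, 2 * ENNReal.ofReal (Real.exp (-(L + 2 * m))) := Finset.sum_le_sum hA
    _ = 2 * (S.card * ENNReal.ofReal (Real.exp (-(L + 2 * m)))) := by
        rw [Finset.sum_const, nsmul_eq_mul]; ring
    _ ≤ 2 * (ENNReal.ofReal (5 ^ m) * ENNReal.ofReal (Real.exp (-(L + 2 * m)))) := by
        gcongr
        rw [ENNReal.ofReal_pow (by norm_num), ENNReal.ofReal_ofNat]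
        exact_mod_cast hS
    _ ≤ _ := by
        rw [← ENNReal.ofReal_mul (by positivity)]
        gcongr
        calc (5 : ℝ) ^ m * Real.exp (-(L + 2 * m)) ≤
            Real.exp (2 * m) * Real.exp (-(L + 2 * m)) := by gcongr
          _ = Real.exp (-L) := by rw [← Real.exp_add]; ring_nf

variable {d : ℕ}

/-- On a half-net, closeness of the empirical Gram form to `n` times the identity, with relative
error `1/8`, bounds the empirical quadratic form from below on the whole space. -/
lemma IsHalfNet.sum_sq_ge {N : Finset (EuclideanSpace ℝ (Fin d))} (hN : IsHalfNet N) {n : ℕ}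
    (z : Fin n → EuclideanSpace ℝ (Fin d))
    (h : ∀ v ∈ N, ∀ w ∈ N,
      |∑ i, inner ℝ v (z i) * inner ℝ w (z i) - n * inner ℝ v w| ≤ n * (1 / 8))
    (u : EuclideanSpace ℝ (Fin d)) :
    n / 2 * ‖u‖ ^ 2 ≤ ∑ i, inner ℝ u (z i) ^ 2 := by
  -- the bilinear form `(a, b) ↦ ∑ ⟨a, zᵢ⟩ ⟨b, zᵢ⟩ - n ⟨a, b⟩`, as a linear form in either slot
  let l : EuclideanSpace ℝ (Fin d) → EuclideanSpace ℝ (Fin d) →ₗ[ℝ] ℝ := fun w =>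
    { toFun := fun v => ∑ i, inner ℝ v (z i) * inner ℝ w (z i) - n * inner ℝ v w
      map_add' := fun a b => by
        simp only [inner_add_left, add_mul, Finset.sum_add_distrib]; ring
      map_smul' := fun a b => by
        simp only [real_inner_smul_left, RingHom.id_apply, smul_eq_mul, mul_sub, Finset.mul_sum]
        congr 1
        · exact Finset.sum_congr rfl fun i _ => by ring
        · ring }
  have hsymm : ∀ v w, l w v = l v w := fun v w => by
    simp only [l, LinearMap.coe_mk, AddHom.coe_mk, real_inner_comm v w]
    congr 1
    exact Finset.sum_congr rfl fun i _ => mul_comm _ _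
  have h1 : ∀ w ∈ N, |l u w| ≤ 2 * (n * (1 / 8)) * ‖u‖ := by
    intro w hw
    rw [hsymm]
    exact hN.abs_map_le (l w) (by positivity) (fun v hv => h v hv w hw) u
  have h2 := hN.abs_map_le (l u) (by positivity) h1 u
  have h3 : l u u = ∑ i, inner ℝ u (z i) ^ 2 - n * ‖u‖ ^ 2 := by
    simp only [l, LinearMap.coe_mk, AddHom.coe_mk, real_inner_self_eq_norm_sq]
    congr 1
    exact Finset.sum_congr rfl fun i _ => (sq _).symm
  rw [h3] at h2
  have h4 := (abs_le.1 h2).1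
  nlinarith

/-- Self-normalised bound for i.i.d. pairs `(Z, r)` with `Z` isotropic and uncorrelated with `r`.
If `n` is large compared with `d + L`, the empirical Gram matrix is close to the identity and
`∑ rᵢ Zᵢ` concentrates, both by Bernstein's inequality on a net. Otherwise Cauchy–Schwarz and a
crude bound on `∑ rᵢ²` suffice. The threshold `16384 (d + L) / c²` for `n` makes Bernstein's
exponent `n c² / 4096` at accuracy `1/8` beat the number `25 ^ d` of pairs of net points. -/
theorem measure_pi_not_selfNormalised_le (P : Measure Ω) [IsProbabilityMeasure P] (n : ℕ)
    {Z : Ω → EuclideanSpace ℝ (Fin d)} {r : Ω → ℝ} (hZ : Measurable Z) (hr : Measurable r)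
    {c : ℝ} (hc : 0 < c) (hc1 : c ≤ 1)
    (hZexp : ∀ v : EuclideanSpace ℝ (Fin d), ‖v‖ ≤ 1 →
      ∫⁻ ω, ENNReal.ofReal (Real.exp (c * (inner ℝ v (Z ω)) ^ 2)) ∂P ≤ 2)
    (hrexp : ∫⁻ ω, ENNReal.ofReal (Real.exp (c * r ω ^ 2)) ∂P ≤ 2)
    (hiso : ∀ u v : EuclideanSpace ℝ (Fin d),
      ∫ ω, inner ℝ u (Z ω) * inner ℝ v (Z ω) ∂P = inner ℝ u v)
    (horth : ∀ v : EuclideanSpace ℝ (Fin d), ∫ ω, inner ℝ v (Z ω) * r ω ∂P = 0)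
    {L : ℝ} (hL : 0 ≤ L) :
    Measure.pi (fun _ : Fin n => P)
      {D | ¬ ∀ u : EuclideanSpace ℝ (Fin d), (∑ i, inner ℝ u (Z (D i)) * r (D i)) ^ 2 ≤
        16385 / c ^ 3 * (d + L) * ∑ i, inner ℝ u (Z (D i)) ^ 2} ≤
      4 * ENNReal.ofReal (Real.exp (-L)) := by
  set Q := Measure.pi (fun _ : Fin n => P)
  have hin : ∀ v : EuclideanSpace ℝ (Fin d), Measurable fun ω => inner ℝ v (Z ω) := fun v => by
    fun_prop
  have hc3 : c ^ 3 ≤ c ^ 2 := by nlinarith [sq_nonneg c]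
  have hdL : 0 ≤ (d : ℝ) + L := by positivity
  rcases lt_or_ge (n : ℝ) (16384 / c ^ 2 * (d + L)) with hn | hn
  · have h1 := measure_pi_sum_ge_le P n (h := fun ω => c * r ω ^ 2) (by fun_prop)
      (κ := Real.log 2) (by rw [Real.exp_log two_pos]; simpa using hrexp) (n * Real.log 2 + L)
    rw [show (n : ℝ) * Real.log 2 - (n * Real.log 2 + L) = -L by ring] at h1
    refine le_trans (measure_mono ?_) (h1.trans ?_)
    · intro D hD
      contrapose! hD
      simp only [Set.mem_ofPred_eq, not_le, not_lt, not_exists] at hD ⊢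
      intro u
      rw [← Finset.mul_sum] at hD
      have h2 : ∑ i, r (D i) ^ 2 ≤ 16385 / c ^ 3 * (d + L) := by
        have h3 : c * ∑ i, r (D i) ^ 2 ≤ 16384 / c ^ 2 * (d + L) + L := by
          have : Real.log 2 ≤ 1 := by linarith [Real.log_two_lt_d9]
          have : (n : ℝ) * Real.log 2 ≤ n := mul_le_of_le_one_right (by positivity) this
          linarith
        have h4 : L ≤ 1 / c ^ 2 * (d + L) := by
          have : 1 ≤ 1 / c ^ 2 := by
            rw [le_div_iff₀ (by positivity), one_mul]
            exact pow_le_one₀ hc.le hc1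
          have hd : (0 : ℝ) ≤ d := by positivity
          nlinarith
        have h5 : c * (16385 / c ^ 3 * (d + L)) =
            16384 / c ^ 2 * (d + L) + 1 / c ^ 2 * (d + L) := by
          field_simp; ring
        refine le_of_mul_le_mul_left ?_ hc
        rw [h5]; linarith
      refine (Finset.sum_mul_sq_le_sq_mul_sq _ _ _).trans ?_
      rw [mul_comm]
      gcongr
    · exact le_mul_of_one_le_left' (by norm_num)
  · obtain ⟨N, hN, hcard⟩ := exists_isHalfNet (E := EuclideanSpace ℝ (Fin d))
    rw [finrank_euclideanSpace_fin] at hcard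
    rcases eq_or_ne n 0 with rfl | hn0
    · simp
    have hnpos : (0 : ℝ) < n := by positivity
    -- the deviation level making each cross term exponentially unlikely with exponent `L + 2 d`
    set t := √(64 * (L + 2 * d) / (c ^ 2 * n)) with ht
    have htsq : t ^ 2 = 64 * (L + 2 * d) / (c ^ 2 * n) := Real.sq_sqrt (by positivity)
    rw [div_mul_eq_mul_div, div_le_iff₀ (by positivity)] at hn
    have ht1 : t ≤ 1 := by
      rw [ht, Real.sqrt_le_one, div_le_one (by positivity)]
      nlinarith
    have hgram := measure_biUnion_exp_le Q (N ×ˢ N) (fun p => {D : Fin n → Ω | n * (1 / 8 : ℝ) ≤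
        |∑ i, inner ℝ p.1 (Z (D i)) * inner ℝ p.2 (Z (D i)) - n * inner ℝ p.1 p.2|})
      (m := 2 * d) (L := L) (by
        rw [Finset.card_product, two_mul, pow_add]; exact Nat.mul_le_mul hcard hcard)
      (fun p hp => by
        obtain ⟨hp1, hp2⟩ := Finset.mem_product.1 hp
        have := measure_pi_abs_mul_dev_ge_le (P := P) n (hin p.1) (hin p.2) hc hc1
          (hZexp _ (hN.1 _ hp1)) (hZexp _ (hN.1 _ hp2)) (t := 1 / 8) (by norm_num) (by norm_num)
        rw [hiso] at this
        refine this.trans ?_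
        gcongr
        push_cast
        nlinarith)
    have hcross := measure_biUnion_exp_le Q N (fun v => {D : Fin n → Ω | n * t ≤
        |∑ i, inner ℝ v (Z (D i)) * r (D i)|}) (m := d) (L := L) hcard
      (fun v hv => by
        have := measure_pi_abs_mul_dev_ge_le (P := P) n (hin v) hr hc hc1
          (hZexp _ (hN.1 _ hv)) hrexp (t := t) (Real.sqrt_nonneg _) ht1
        rw [horth, htsq] at this
        simp only [mul_zero, sub_zero] at this
        refine this.trans (le_of_eq ?_)
        congr 4
        field_simp)
    rw [show (4 : ℝ≥0∞) = 2 + 2 by norm_num, add_mul]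
    refine (measure_mono ?_).trans ((measure_union_le _ _).trans (add_le_add hgram hcross))
    intro D hD
    contrapose! hD
    simp only [Set.mem_union, Set.mem_iUnion, Set.mem_ofPred_eq, not_or, not_exists, not_le, not_lt,
      Finset.mem_product] at hD ⊢
    intro u
    have hg := hN.sum_sq_ge (fun i => Z (D i))
      (fun v hv w hw => (hD.1 (v, w) ⟨hv, hw⟩).le) u
    let l : EuclideanSpace ℝ (Fin d) →ₗ[ℝ] ℝ :=
      { toFun := fun v => ∑ i, inner ℝ v (Z (D i)) * r (D i)
        map_add' := fun a b => by simp only [inner_add_left, add_mul, Finset.sum_add_distrib]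
        map_smul' := fun a b => by
          simp only [real_inner_smul_left, RingHom.id_apply, smul_eq_mul, Finset.mul_sum,
            mul_assoc] }
    have hl : |∑ i, inner ℝ u (Z (D i)) * r (D i)| ≤ 2 * (n * t) * ‖u‖ :=
      hN.abs_map_le l (by positivity) (fun v hv => (hD.2 v hv).le) u
    have hsq : (∑ i, inner ℝ u (Z (D i)) * r (D i)) ^ 2 ≤ (2 * (n * t) * ‖u‖) ^ 2 := by
      rw [← sq_abs]; gcongr
    have hrw : (2 * (n * t) * ‖u‖) ^ 2 = 512 / c ^ 2 * (L + 2 * d) * (n / 2 * ‖u‖ ^ 2) := by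
      rw [mul_pow, mul_pow, mul_pow, htsq]; field_simp; ring
    rw [hrw] at hsq
    refine hsq.trans ?_
    have hconst : 512 / c ^ 2 * (L + 2 * d) ≤ 16385 / c ^ 3 * (d + L) := by
      rw [div_mul_eq_mul_div, div_mul_eq_mul_div,
        div_le_div_iff₀ (by positivity) (by positivity)]
      have hd : (0 : ℝ) ≤ d := by positivity
      have : 512 * (L + 2 * d) ≤ 16385 * (d + L) := by linarith
      exact mul_le_mul this hc3 (by positivity) (by positivity)
    exact mul_le_mul hconst hg (by positivity) (by positivity)

end SelfNormalised

/-! ### Positive definite matrices -/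

section LinearAlgebra

variable {d e : ℕ}

lemma invSqrt_mul_invSqrt {S : Matrix (Fin d) (Fin d) ℝ} (hS : S.PosDef) :
    invSqrt S * invSqrt S = S⁻¹ := by
  have hsa : IsSelfAdjoint S := hS.isHermitian
  have hpos : ∀ x ∈ spectrum ℝ S, 0 < x := by
    intro x hx
    rw [hS.isHermitian.spectrum_real_eq_range_eigenvalues] at hx
    obtain ⟨i, rfl⟩ := hx
    exact hS.eigenvalues_pos i
  have hcont : ContinuousOn (fun t : ℝ => (√t)⁻¹) (spectrum ℝ S) :=
    Real.continuous_sqrt.continuousOn.inv₀ fun x hx => (Real.sqrt_pos.2 (hpos x hx)).ne'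
  unfold invSqrt
  rw [← cfc_mul _ _ S hcont hcont]
  have h1 : cfc (fun x : ℝ => (√x)⁻¹ * (√x)⁻¹) S = cfc (fun x : ℝ => x⁻¹) S := by
    refine cfc_congr fun x hx => ?_
    rw [← mul_inv, Real.mul_self_sqrt (hpos x hx).le]
  rw [h1, Matrix.nonsing_inv_eq_ringInverse]
  exact cfc_ringInverse_id S hS.isUnit

lemma invSqrt_transpose (S : Matrix (Fin d) (Fin d) ℝ) : (invSqrt S)ᵀ = invSqrt S := by
  have : IsSelfAdjoint (invSqrt S) := cfc_predicate _ _
  have h := this.star_eq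
  rwa [Matrix.star_eq_conjTranspose, Matrix.conjTranspose_eq_transpose_of_trivial] at h

lemma mul_invSqrt_mul_invSqrt {S : Matrix (Fin d) (Fin d) ℝ} (hS : S.PosDef) :
    S * invSqrt S * invSqrt S = 1 := by
  rw [Matrix.mul_assoc, invSqrt_mul_invSqrt hS,
    Matrix.mul_nonsing_inv _ ((Matrix.isUnit_iff_isUnit_det _).1 hS.isUnit)]

lemma invSqrt_mul_mul_invSqrt {S : Matrix (Fin d) (Fin d) ℝ} (hS : S.PosDef) :
    invSqrt S * S * invSqrt S = 1 := by
  have := mul_invSqrt_mul_invSqrt hS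
  rw [mul_eq_one_comm] at this
  rwa [Matrix.mul_assoc]

lemma dotProduct_mulVec_comm_of_isHermitian {V : Matrix (Fin d) (Fin d) ℝ} (hV : V.IsHermitian)
    (v w : Fin d → ℝ) : v ⬝ᵥ (V *ᵥ w) = w ⬝ᵥ (V *ᵥ v) := by
  have h : Vᵀ = V := by rw [← Matrix.conjTranspose_eq_transpose_of_trivial]; exact hV
  rw [Matrix.dotProduct_mulVec, ← Matrix.mulVec_transpose, h, dotProduct_comm]

lemma dotProduct_mulVec_self_nonneg {V : Matrix (Fin d) (Fin d) ℝ} (hV : V.PosDef)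
    (w : Fin d → ℝ) : 0 ≤ w ⬝ᵥ (V *ᵥ w) := by
  simpa using hV.posSemidef.dotProduct_mulVec_nonneg w

lemma mulVec_inv_mulVec {V : Matrix (Fin d) (Fin d) ℝ} (hV : V.PosDef) (x : Fin d → ℝ) :
    V *ᵥ (V⁻¹ *ᵥ x) = x := by
  rw [Matrix.mulVec_mulVec, Matrix.mul_nonsing_inv _ ((Matrix.isUnit_iff_isUnit_det _).1 hV.isUnit),
    Matrix.one_mulVec]

lemma sq_mahalanobis_inv {V : Matrix (Fin d) (Fin d) ℝ} (hV : V.PosDef)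
    (x : EuclideanSpace ℝ (Fin d)) :
    mahalanobis V⁻¹ x ^ 2 = x.ofLp ⬝ᵥ (V⁻¹ *ᵥ x.ofLp) :=
  Real.sq_sqrt (dotProduct_mulVec_self_nonneg hV.inv _)

/-- Fenchel's inequality for the quadratic form of `V`. -/
lemma two_mul_dotProduct_sub_le_sq_mahalanobis {V : Matrix (Fin d) (Fin d) ℝ} (hV : V.PosDef)
    (x : EuclideanSpace ℝ (Fin d)) (w : Fin d → ℝ) :
    2 * (x.ofLp ⬝ᵥ w) - w ⬝ᵥ (V *ᵥ w) ≤ mahalanobis V⁻¹ x ^ 2 := by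
  have h := dotProduct_mulVec_self_nonneg hV (w - V⁻¹ *ᵥ x.ofLp)
  rw [Matrix.mulVec_sub, mulVec_inv_mulVec hV, sub_dotProduct, dotProduct_sub, dotProduct_sub,
    dotProduct_mulVec_comm_of_isHermitian hV.isHermitian (V⁻¹ *ᵥ x.ofLp) w, mulVec_inv_mulVec hV,
    dotProduct_comm w x.ofLp, dotProduct_comm (V⁻¹ *ᵥ x.ofLp) x.ofLp] at h
  rw [sq_mahalanobis_inv hV]
  linarith

/-- Equality in Fenchel's inequality at `w = V⁻¹ x`. -/
lemma sq_mahalanobis_eq {V : Matrix (Fin d) (Fin d) ℝ} (hV : V.PosDef)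
    (x : EuclideanSpace ℝ (Fin d)) :
    mahalanobis V⁻¹ x ^ 2 = 2 * (x.ofLp ⬝ᵥ (V⁻¹ *ᵥ x.ofLp)) -
      (V⁻¹ *ᵥ x.ofLp) ⬝ᵥ (V *ᵥ (V⁻¹ *ᵥ x.ofLp)) := by
  rw [sq_mahalanobis_inv hV, mulVec_inv_mulVec hV, dotProduct_comm (V⁻¹ *ᵥ x.ofLp)]
  ring

lemma mahalanobis_nonneg (S : Matrix (Fin d) (Fin d) ℝ) (x : EuclideanSpace ℝ (Fin d)) :
    0 ≤ mahalanobis S x := Real.sqrt_nonneg _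

/-- Cauchy–Schwarz for the dual norms of `V⁻¹` and `V`. -/
lemma abs_dotProduct_le_mahalanobis_mul {V : Matrix (Fin d) (Fin d) ℝ} (hV : V.PosDef)
    (x : EuclideanSpace ℝ (Fin d)) (w : Fin d → ℝ) :
    |x.ofLp ⬝ᵥ w| ≤ mahalanobis V⁻¹ x * √(w ⬝ᵥ (V *ᵥ w)) := by
  have hq := dotProduct_mulVec_self_nonneg hV w
  have hdisc : ∀ t : ℝ, 0 ≤ (w ⬝ᵥ (V *ᵥ w)) * (t * t) + (-2 * (x.ofLp ⬝ᵥ w)) * t +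
      mahalanobis V⁻¹ x ^ 2 := by
    intro t
    have := two_mul_dotProduct_sub_le_sq_mahalanobis hV x (t • w)
    simp only [dotProduct_smul, smul_dotProduct, Matrix.mulVec_smul, smul_eq_mul] at this
    linarith
  have h := discrim_le_zero hdisc
  rw [discrim] at h
  refine abs_le_of_sq_le_sq ?_ (mul_nonneg (mahalanobis_nonneg _ _) (Real.sqrt_nonneg _))
  rw [mul_pow, Real.sq_sqrt hq]
  linarith

lemma norm_toEuclideanCLM_invSqrt {V : Matrix (Fin d) (Fin d) ℝ} (hV : V.PosDef)
    (x : EuclideanSpace ℝ (Fin d)) :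
    ‖Matrix.toEuclideanCLM (n := Fin d) (𝕜 := ℝ) (invSqrt V) x‖ = mahalanobis V⁻¹ x := by
  rw [← sq_eq_sq₀ (norm_nonneg _) (mahalanobis_nonneg _ _), sq_mahalanobis_inv hV,
    ← invSqrt_mul_invSqrt hV, ← real_inner_self_eq_norm_sq, EuclideanSpace.inner_eq_star_dotProduct,
    star_trivial, Matrix.ofLp_toEuclideanCLM, ← Matrix.mulVec_mulVec,
    Matrix.dotProduct_mulVec x.ofLp, ← Matrix.mulVec_transpose, invSqrt_transpose]

/-! ### Restriction to the first coordinates -/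

/-- The vector of the first `d` coordinates. -/
noncomputable def restrictFirst (h : d ≤ e) (x : EuclideanSpace ℝ (Fin e)) :
    EuclideanSpace ℝ (Fin d) :=
  WithLp.toLp 2 fun i => x (Fin.castLE h i)

/-- Extension of a vector by zeros, meant for `d ≤ e`; surplus coordinates would be
dropped. -/
noncomputable def extendZero (e : ℕ) (w : EuclideanSpace ℝ (Fin d)) :
    EuclideanSpace ℝ (Fin e) :=
  WithLp.toLp 2 fun i => if hi : (i : ℕ) < d then w ⟨i, hi⟩ else 0

lemma dotProduct_extendZero (h : d ≤ e) (x : EuclideanSpace ℝ (Fin e))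
    (w : EuclideanSpace ℝ (Fin d)) :
    x.ofLp ⬝ᵥ (extendZero e w).ofLp = (restrictFirst h x).ofLp ⬝ᵥ w.ofLp := by
  obtain ⟨m, rfl⟩ := Nat.exists_eq_add_of_le h
  simp only [dotProduct, extendZero, restrictFirst, Fin.sum_univ_add]
  simp
  rfl

lemma restrictFirst_extendZero (h : d ≤ e) (w : EuclideanSpace ℝ (Fin d)) :
    restrictFirst h (extendZero e w) = w := by
  ext i
  simp [restrictFirst, extendZero]

lemma dotProduct_self_extendZero (h : d ≤ e) (w : EuclideanSpace ℝ (Fin d)) :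
    (extendZero e w).ofLp ⬝ᵥ (extendZero e w).ofLp = w.ofLp ⬝ᵥ w.ofLp := by
  rw [dotProduct_extendZero h, restrictFirst_extendZero]

lemma inner_eq_dotProduct (x y : EuclideanSpace ℝ (Fin d)) : inner ℝ x y = x.ofLp ⬝ᵥ y.ofLp := by
  rw [EuclideanSpace.inner_eq_star_dotProduct, star_trivial, dotProduct_comm]

lemma norm_extendZero (h : d ≤ e) (w : EuclideanSpace ℝ (Fin d)) : ‖extendZero e w‖ = ‖w‖ := by
  rw [← sq_eq_sq₀ (norm_nonneg _) (norm_nonneg _), ← real_inner_self_eq_norm_sq,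
    ← real_inner_self_eq_norm_sq, inner_eq_dotProduct, inner_eq_dotProduct,
    dotProduct_self_extendZero h]

end LinearAlgebra

/-! ### The regularised empirical covariance and the ridge estimate -/

section Ridge

variable {𝒳 𝒜 : Type*} {d e n : ℕ}

lemma dotProduct_empCov_mulVec (lam : ℝ) (φ : 𝒳 → 𝒜 → EuclideanSpace ℝ (Fin d))
    (D : Dataset 𝒳 𝒜 n) (v w : Fin d → ℝ) :
    v ⬝ᵥ (empCov lam φ D *ᵥ w) = lam / n * (v ⬝ᵥ w) +
      1 / n * ∑ i, ((φ (D i).1 (D i).2.1).ofLp ⬝ᵥ v) * ((φ (D i).1 (D i).2.1).ofLp ⬝ᵥ w) := by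
  simp only [empCov, Matrix.add_mulVec, Matrix.smul_mulVec, Matrix.one_mulVec, Matrix.sum_mulVec,
    Matrix.vecMulVec_mulVec, dotProduct_add, dotProduct_smul, dotProduct_sum, smul_eq_mul,
    op_smul_eq_smul]
  congr 2
  exact Finset.sum_congr rfl fun i _ => by rw [dotProduct_comm v]; ring

lemma empCov_posDef {lam : ℝ} (hlam : 0 < lam) (hn : 0 < n)
    (φ : 𝒳 → 𝒜 → EuclideanSpace ℝ (Fin d)) (D : Dataset 𝒳 𝒜 n) : (empCov lam φ D).PosDef := by
  have hn' : (0 : ℝ) < n := by exact_mod_cast hn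
  refine (Matrix.PosDef.one.smul (by positivity)).add_posSemidef
    ((Matrix.posSemidef_sum _ fun i _ => ?_).smul (by positivity))
  simpa using Matrix.posSemidef_vecMulVec_self_star (φ (D i).1 (D i).2.1).ofLp

/-- `φ` consists of the first coordinates of `ψ`, a relation that, unlike `ModelClasses.Nested`, is
not tied to consecutive classes. -/
def IsPrefix (φ : 𝒳 → 𝒜 → EuclideanSpace ℝ (Fin d)) (ψ : 𝒳 → 𝒜 → EuclideanSpace ℝ (Fin e)) :
    Prop :=
  ∃ h : d ≤ e, ∀ x a, restrictFirst h (ψ x a) = φ x a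

/-- Passing to first coordinates decreases the dual norms: in the variational formula for
`‖x‖²_{V⁻¹}` the test vectors are restricted to a coordinate subspace. -/
lemma mahalanobis_restrictFirst_le {φ : 𝒳 → 𝒜 → EuclideanSpace ℝ (Fin d)}
    {ψ : 𝒳 → 𝒜 → EuclideanSpace ℝ (Fin e)} (h : d ≤ e)
    (hφ : ∀ x a, restrictFirst h (ψ x a) = φ x a) {lam : ℝ} (hlam : 0 < lam) (hn : 0 < n)
    (D : Dataset 𝒳 𝒜 n) (x : EuclideanSpace ℝ (Fin e)) :
    mahalanobis (empCov lam φ D)⁻¹ (restrictFirst h x) ≤ mahalanobis (empCov lam ψ D)⁻¹ x := by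
  refine le_of_sq_le_sq ?_ (mahalanobis_nonneg _ _)
  rw [sq_mahalanobis_eq (empCov_posDef hlam hn φ D)]
  set w : EuclideanSpace ℝ (Fin d) :=
    WithLp.toLp 2 ((empCov lam φ D)⁻¹ *ᵥ (restrictFirst h x).ofLp) with hw
  have h1 := two_mul_dotProduct_sub_le_sq_mahalanobis (empCov_posDef hlam hn ψ D) x
    (extendZero e w).ofLp
  have h2 : (extendZero e w).ofLp ⬝ᵥ (empCov lam ψ D *ᵥ (extendZero e w).ofLp) =
      w.ofLp ⬝ᵥ (empCov lam φ D *ᵥ w.ofLp) := by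
    simp only [dotProduct_empCov_mulVec, dotProduct_self_extendZero h, dotProduct_extendZero h, hφ]
  rw [h2, dotProduct_extendZero h] at h1
  exact h1

lemma specNorm_invSqrt_empCov_mono {φ : 𝒳 → 𝒜 → EuclideanSpace ℝ (Fin d)}
    {ψ : 𝒳 → 𝒜 → EuclideanSpace ℝ (Fin e)} (hφψ : IsPrefix φ ψ) {lam : ℝ} (hlam : 0 < lam)
    (hn : 0 < n) (D : Dataset 𝒳 𝒜 n) :
    specNorm (invSqrt (empCov lam φ D)) ≤ specNorm (invSqrt (empCov lam ψ D)) := by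
  obtain ⟨h, hφ⟩ := hφψ
  refine ContinuousLinearMap.opNorm_le_bound _ (norm_nonneg _) fun x => ?_
  rw [norm_toEuclideanCLM_invSqrt (empCov_posDef hlam hn φ D)]
  calc _ = mahalanobis (empCov lam φ D)⁻¹ (restrictFirst h (extendZero e x)) := by
        rw [restrictFirst_extendZero]
    _ ≤ mahalanobis (empCov lam ψ D)⁻¹ (extendZero e x) :=
        mahalanobis_restrictFirst_le h hφ hlam hn D _
    _ = ‖Matrix.toEuclideanCLM (n := Fin e) (𝕜 := ℝ) (invSqrt (empCov lam ψ D)) (extendZero e x)‖ :=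
        (norm_toEuclideanCLM_invSqrt (empCov_posDef hlam hn ψ D) _).symm
    _ ≤ _ := by
        refine (ContinuousLinearMap.le_opNorm _ _).trans (le_of_eq ?_)
        rw [norm_extendZero h, specNorm]

/-- Basic inequality for ridge regression with `λ = 1` around a point `θ` of norm at most `1`: a
self-normalised bound on the residual sums controls the estimation error in the norm of `V`. -/
lemma sqrt_ridge_error_le (hn : 0 < n) (φ : 𝒳 → 𝒜 → EuclideanSpace ℝ (Fin d))
    (D : Dataset 𝒳 𝒜 n) (θ : EuclideanSpace ℝ (Fin d)) (hθ : ‖θ‖ ≤ 1) {G : ℝ}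
    (hG : ∀ w : EuclideanSpace ℝ (Fin d),
      (∑ i, inner ℝ (φ (D i).1 (D i).2.1) w *
        ((D i).2.2 - inner ℝ (φ (D i).1 (D i).2.1) θ)) ^ 2 ≤
      G * ∑ i, inner ℝ (φ (D i).1 (D i).2.1) w ^ 2) (hG0 : 0 ≤ G) :
    √((ridge 1 φ D - θ).ofLp ⬝ᵥ (empCov 1 φ D *ᵥ (ridge 1 φ D - θ).ofLp)) ≤
      √(1 / n) + √(G / n) := by
  have hn' : (0 : ℝ) < n := by exact_mod_cast hn
  have hV := empCov_posDef one_pos hn φ D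
  set w := ridge 1 φ D - θ with hw
  set Q := w.ofLp ⬝ᵥ (empCov 1 φ D *ᵥ w.ofLp) with hQ
  have hQ0 : 0 ≤ Q := dotProduct_mulVec_self_nonneg hV _
  have hquad : Q = 1 / n * ‖w‖ ^ 2 + 1 / n * ∑ i, inner ℝ (φ (D i).1 (D i).2.1) w ^ 2 := by
    rw [hQ, dotProduct_empCov_mulVec, ← real_inner_self_eq_norm_sq]
    simp only [inner_eq_dotProduct, sq]
  have heq : Q = 1 / n * ∑ i, inner ℝ (φ (D i).1 (D i).2.1) w *
      ((D i).2.2 - inner ℝ (φ (D i).1 (D i).2.1) θ) - 1 / n * inner ℝ w θ := by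
    have h1 : empCov 1 φ D *ᵥ w.ofLp =
        (1 / (n : ℝ)) • ∑ i, (D i).2.2 • (φ (D i).1 (D i).2.1).ofLp -
          empCov 1 φ D *ᵥ θ.ofLp := by
      rw [hw, WithLp.ofLp_sub, Matrix.mulVec_sub, ridge, mulVec_inv_mulVec hV]
    rw [hQ, h1, dotProduct_sub, dotProduct_empCov_mulVec, dotProduct_smul, dotProduct_sum,
      ← inner_eq_dotProduct, smul_eq_mul]
    simp only [dotProduct_smul, smul_eq_mul, mul_sub, Finset.sum_sub_distrib, inner_eq_dotProduct]
    have : ∀ i, (D i).2.2 * (w.ofLp ⬝ᵥ (φ (D i).1 (D i).2.1).ofLp) =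
        ((φ (D i).1 (D i).2.1).ofLp ⬝ᵥ w.ofLp) * (D i).2.2 := fun i => by
      rw [dotProduct_comm, mul_comm]
    simp only [this]
    ring
  have hS : 0 ≤ ∑ i, inner ℝ (φ (D i).1 (D i).2.1) w ^ 2 := Finset.sum_nonneg fun i _ => sq_nonneg _
  have hle1 : ∑ i, inner ℝ (φ (D i).1 (D i).2.1) w ^ 2 ≤ n * Q := by
    rw [hquad, mul_add, ← mul_assoc, ← mul_assoc, mul_one_div_cancel hn'.ne']
    nlinarith [sq_nonneg ‖w‖]
  have hle2 : ‖w‖ ^ 2 ≤ n * Q := by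
    rw [hquad, mul_add, ← mul_assoc, ← mul_assoc, mul_one_div_cancel hn'.ne']
    linarith
  have hb1 : 1 / n * ∑ i, inner ℝ (φ (D i).1 (D i).2.1) w *
      ((D i).2.2 - inner ℝ (φ (D i).1 (D i).2.1) θ) ≤ √(G / n) * √Q := by
    rw [← Real.sqrt_mul (by positivity)]
    refine Real.le_sqrt_of_sq_le ?_
    have h3 := (hG w).trans (mul_le_mul_of_nonneg_left hle1 hG0)
    calc _ = (1 / (n : ℝ)) ^ 2 * (∑ i, inner ℝ (φ (D i).1 (D i).2.1) w *
          ((D i).2.2 - inner ℝ (φ (D i).1 (D i).2.1) θ)) ^ 2 := by rw [mul_pow]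
      _ ≤ (1 / (n : ℝ)) ^ 2 * (G * (n * Q)) := by gcongr
      _ = G / n * Q := by field_simp
  have hb2 : -(1 / n * inner ℝ w θ) ≤ √(1 / n) * √Q := by
    rw [← Real.sqrt_mul (by positivity)]
    refine Real.le_sqrt_of_sq_le ?_
    have h4 : (inner ℝ w θ) ^ 2 ≤ n * Q := by
      refine le_trans ?_ hle2
      rw [← sq_abs]
      gcongr
      exact (abs_real_inner_le_norm w θ).trans (mul_le_of_le_one_right (norm_nonneg _) hθ)
    calc _ = (1 / (n : ℝ)) ^ 2 * (inner ℝ w θ) ^ 2 := by ring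
      _ ≤ (1 / (n : ℝ)) ^ 2 * (n * Q) := by gcongr
      _ = 1 / n * Q := by field_simp
  have hfin : √Q * √Q ≤ (√(1 / n) + √(G / n)) * √Q := by
    rw [Real.mul_self_sqrt hQ0, add_mul]
    linarith
  rcases (Real.sqrt_nonneg Q).eq_or_lt with h0 | h0
  · rw [← h0]; positivity
  · exact le_of_mul_le_mul_right hfin h0

end Ridge

/-! ### Change of measure by concentrability, and the law of one interaction -/

section Population

variable {𝒳 𝒜 : Type*} [MeasurableSpace 𝒳] [MeasurableSpace 𝒜] [MeasurableSingletonClass 𝒜]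

/-- Testing the supremum with the policy that always plays `a`. -/
lemma one_le_concentrability_mul {μ : Kernel 𝒳 𝒜} [IsMarkovKernel μ]
    (hC : concentrability μ ≠ ∞) (x : 𝒳) (a : 𝒜) : 1 ≤ concentrability μ * μ x {a} := by
  have h1 : 1 / μ x {a} ≤ concentrability μ := by
    have := le_iSup_of_le (f := fun π : {π : Kernel 𝒳 𝒜 // IsMarkovKernel π} =>
      ⨆ (x : 𝒳) (a : 𝒜), π.1 x {a} / μ x {a}) ⟨Kernel.const 𝒳 (Measure.dirac a), inferInstance⟩
      (le_iSup₂_of_le x a le_rfl)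
    simpa [concentrability] using this
  have h0 : μ x {a} ≠ 0 := by
    intro h0
    rw [h0, ENNReal.div_zero one_ne_zero, top_le_iff] at h1
    exact hC h1
  rwa [ENNReal.div_le_iff_le_mul (Or.inl h0) (Or.inl (measure_ne_top _ _))] at h1

/-- Expectations of nonnegative functions under a policy are at most `C(μ)` times those under
`μ`. -/
lemma lintegral_policy_le {B : Bandit 𝒳 𝒜} {μ : Kernel 𝒳 𝒜} [IsMarkovKernel μ]
    (hC : concentrability μ ≠ ∞) (π : 𝒳 → 𝒜) {g : 𝒳 × 𝒜 → ℝ≥0∞} (hg : Measurable g) :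
    ∫⁻ x, g (x, π x) ∂B.stateLaw ≤ concentrability μ * ∫⁻ z, g z ∂B.stateAction μ := by
  rw [Bandit.stateAction, Measure.lintegral_compProd hg,
    ← lintegral_const_mul _ (hg.lintegral_kernel_prod_right')]
  refine lintegral_mono fun x => ?_
  calc g (x, π x) ≤ (concentrability μ * μ x {π x}) * g (x, π x) :=
        le_mul_of_one_le_left' (one_le_concentrability_mul hC x _)
    _ = concentrability μ * ∫⁻ a in {π x}, g (x, a) ∂μ x := by
        rw [Measure.restrict_singleton, lintegral_smul_measure, lintegral_dirac, smul_eq_mul,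
          mul_assoc]
    _ ≤ _ := by gcongr; exact Measure.restrict_le_self

variable [Finite 𝒜]

lemma measurable_eval_pair :
    Measurable fun z : 𝒳 × 𝒜 × (𝒜 → ℝ) => z.2.2 z.2.1 := by
  have : Measurable fun z : (𝒳 × (𝒜 → ℝ)) × 𝒜 => z.1.2 z.2 :=
    measurable_from_prod_countable_left fun a =>
      (measurable_pi_apply a).comp measurable_snd
  exact this.comp (f := fun z : 𝒳 × 𝒜 × (𝒜 → ℝ) => ((z.1, z.2.2), z.2.1)) (by fun_prop)

lemma Bandit.measurable_meanReward (B : Bandit 𝒳 𝒜) :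
    Measurable fun z : 𝒳 × 𝒜 => B.meanReward z.1 z.2 := by
  refine measurable_from_prod_countable_left fun a => ?_
  have h : StronglyMeasurable fun y : 𝒜 → ℝ => y a := (measurable_pi_apply a).stronglyMeasurable
  exact (h.integral_kernel (κ := B.rewardLaw)).measurable

lemma measurable_featurePair {d : ℕ} {φ : 𝒳 → 𝒜 → EuclideanSpace ℝ (Fin d)}
    (hφ : ∀ a, Measurable fun x => φ x a) : Measurable (featurePair φ) :=
  measurable_from_prod_countable_left hφ

variable (B : Bandit 𝒳 𝒜) (μ : Kernel 𝒳 𝒜) [IsMarkovKernel μ]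

instance : IsProbabilityMeasure (B.stateAction μ) := by
  unfold Bandit.stateAction; infer_instance

lemma Bandit.measurable_record : Measurable
    fun z : 𝒳 × 𝒜 × (𝒜 → ℝ) => (z.1, z.2.1, z.2.2 z.2.1) :=
  measurable_fst.prodMk ((measurable_fst.comp measurable_snd).prodMk measurable_eval_pair)

instance : IsProbabilityMeasure (B.sampleLaw μ) := by
  unfold Bandit.sampleLaw
  exact Measure.isProbabilityMeasure_map Bandit.measurable_record.aemeasurable

lemma Bandit.lintegral_sampleLaw {g : 𝒳 × 𝒜 × ℝ → ℝ≥0∞} (hg : Measurable g) :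
    ∫⁻ z, g z ∂B.sampleLaw μ =
      ∫⁻ x, ∫⁻ a, ∫⁻ y, g (x, a, y a) ∂B.rewardLaw x ∂μ x ∂B.stateLaw := by
  have hg' : Measurable fun z : 𝒳 × 𝒜 × (𝒜 → ℝ) => g (z.1, z.2.1, z.2.2 z.2.1) :=
    hg.comp Bandit.measurable_record
  rw [Bandit.sampleLaw, lintegral_map hg Bandit.measurable_record, Measure.lintegral_compProd hg']
  refine lintegral_congr fun x => ?_
  have hx : Measurable fun w : 𝒜 × (𝒜 → ℝ) => g (x, w.1, w.2 w.1) :=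
    hg'.comp measurable_prodMk_left
  rw [Kernel.lintegral_prod _ _ _ hx]

/-- The state and the action of an interaction follow the law of `(X, A)`. -/
lemma Bandit.measurePreserving_stateAction :
    MeasurePreserving (fun z : 𝒳 × 𝒜 × ℝ => (z.1, z.2.1)) (B.sampleLaw μ) (B.stateAction μ) := by
  have hm : Measurable fun z : 𝒳 × 𝒜 × ℝ => (z.1, z.2.1) := by fun_prop
  refine ⟨hm, Measure.ext_of_lintegral _ fun g hg => ?_⟩
  have hgm : Measurable fun z : 𝒳 × 𝒜 × ℝ => g (z.1, z.2.1) := hg.comp hm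
  rw [lintegral_map hg hm, B.lintegral_sampleLaw μ hgm, Bandit.stateAction,
    Measure.lintegral_compProd hg]
  simp

lemma Bandit.ae_stateAction_of_ae {p : 𝒳 → 𝒜 → Prop}
    (h : ∀ᵐ x ∂B.stateLaw, ∀ a, p x a) : ∀ᵐ z ∂B.stateAction μ, p z.1 z.2 := by
  have h1 : ∀ᵐ z ∂B.stateAction μ, ∀ a, p z.1 a := by
    have hq : Measure.QuasiMeasurePreserving Prod.fst (B.stateAction μ) B.stateLaw := by
      refine ⟨measurable_fst, ?_⟩
      rw [Bandit.stateAction, ← Measure.fst, Measure.fst_compProd]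
    exact hq.ae h
  exact h1.mono fun z hz => hz z.2

/-- The noise in the recorded reward is uncorrelated with any function of state and action. -/
lemma Bandit.integral_mul_noise_eq_zero {g : 𝒳 × 𝒜 → ℝ} (hg : Measurable g)
    (hint : Integrable (fun z => g (z.1, z.2.1) * (z.2.2 - B.meanReward z.1 z.2.1))
      (B.sampleLaw μ)) :
    ∫ z, g (z.1, z.2.1) * (z.2.2 - B.meanReward z.1 z.2.1) ∂B.sampleLaw μ = 0 := by
  have hf := B.measurable_meanReward
  have hm : Measurable fun z : 𝒳 × 𝒜 × ℝ =>
      g (z.1, z.2.1) * (z.2.2 - B.meanReward z.1 z.2.1) := by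
    have h1 : Measurable fun z : 𝒳 × 𝒜 × ℝ => (z.1, z.2.1) := by fun_prop
    exact (hg.comp h1).mul (measurable_snd.snd.sub (hf.comp h1))
  rw [Bandit.sampleLaw] at hint ⊢
  rw [integrable_map_measure hm.aestronglyMeasurable Bandit.measurable_record.aemeasurable] at hint
  simp only [Function.comp_def] at hint
  rw [integral_map Bandit.measurable_record.aemeasurable hm.aestronglyMeasurable,
    Measure.integral_compProd hint]
  have hx := ((Measure.integrable_compProd_iff hint.aestronglyMeasurable).1 hint).1
  refine integral_eq_zero_of_ae (hx.mono fun x hx => ?_)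
  simp only [Pi.zero_apply]
  rw [Kernel.prod_apply] at hx ⊢
  rw [integral_prod _ hx]
  refine integral_eq_zero_of_ae (ae_of_all _ fun a => ?_)
  simp only [Pi.zero_apply]
  rw [integral_const_mul]
  refine mul_eq_zero_of_right _ ?_
  -- without integrability both the mean reward and the centred integral are zero
  by_cases hy : Integrable (fun y : 𝒜 → ℝ => y a) (B.rewardLaw x)
  · rw [integral_sub hy (integrable_const _)]
    simp [Bandit.meanReward]
  · refine integral_undef fun h => hy ?_
    exact (h.add (integrable_const (B.meanReward x a))).congr (ae_of_all _ fun y => by simp)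

end Population

/-! ### Whitened features -/

section Whitening

variable {Ω : Type*} [MeasurableSpace Ω] {P : Measure Ω}

lemma memLp_two_of_lintegral_exp_sq {g : Ω → ℝ} (hg : Measurable g) {c : ℝ} (hc : 0 < c)
    (h : ∫⁻ ω, ENNReal.ofReal (Real.exp (c * g ω ^ 2)) ∂P ≤ 2) : MemLp g 2 P := by
  rw [memLp_two_iff_integrable_sq hg.aestronglyMeasurable]
  refine Integrable.mono' ((integral_exp_le_of_lintegral (by fun_prop) h).1.const_mul (1 / c))
    (by fun_prop) (ae_of_all _ fun ω => ?_)
  rw [Real.norm_of_nonneg (sq_nonneg _), one_div, ← div_eq_inv_mul, le_div_iff₀ hc]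
  linarith [Real.add_one_le_exp (c * g ω ^ 2)]

/-- Cauchy–Schwarz in the exponent followed by `p q r ≤ (p³ + q³ + r³) / 3`. -/
lemma exp_sq_add_add_le {c : ℝ} (hc : 0 ≤ c) (x y z : ℝ) :
    Real.exp (c * (x + y + z) ^ 2) ≤ (Real.exp (9 * c * x ^ 2) + Real.exp (9 * c * y ^ 2) +
      Real.exp (9 * c * z ^ 2)) / 3 := by
  have h1 : Real.exp (c * (x + y + z) ^ 2) ≤
      Real.exp (3 * c * x ^ 2) * Real.exp (3 * c * y ^ 2) * Real.exp (3 * c * z ^ 2) := by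
    rw [← Real.exp_add, ← Real.exp_add, Real.exp_le_exp]
    nlinarith [mul_nonneg hc (sq_nonneg (x - y)), mul_nonneg hc (sq_nonneg (y - z)),
      mul_nonneg hc (sq_nonneg (x - z))]
  have h3 : ∀ t : ℝ, Real.exp (9 * c * t ^ 2) = Real.exp (3 * c * t ^ 2) ^ 3 := fun t => by
    rw [← Real.exp_nat_mul]; congr 1; push_cast; ring
  rw [h3 x, h3 y, h3 z]
  refine h1.trans ?_
  have hp := Real.exp_pos (3 * c * x ^ 2)
  have hq := Real.exp_pos (3 * c * y ^ 2)
  have hr := Real.exp_pos (3 * c * z ^ 2)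
  nlinarith [mul_nonneg (add_pos (add_pos hp hq) hr).le
    (add_nonneg (add_nonneg (sq_nonneg (Real.exp (3 * c * x ^ 2) - Real.exp (3 * c * y ^ 2)))
      (sq_nonneg (Real.exp (3 * c * y ^ 2) - Real.exp (3 * c * z ^ 2))))
      (sq_nonneg (Real.exp (3 * c * x ^ 2) - Real.exp (3 * c * z ^ 2))))]

end Whitening

section Model

variable {𝒳 𝒜 : Type*} [MeasurableSpace 𝒳] [MeasurableSpace 𝒜] [MeasurableSingletonClass 𝒜]
  [Finite 𝒜] {B : Bandit 𝒳 𝒜} {μ : Kernel 𝒳 𝒜} [IsMarkovKernel μ] {d : ℕ}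
  {φ : 𝒳 → 𝒜 → EuclideanSpace ℝ (Fin d)}

/-- The whitened features `Σ^{-1/2} φ`. -/
noncomputable def Bandit.whitened (B : Bandit 𝒳 𝒜) (μ : Kernel 𝒳 𝒜)
    (φ : 𝒳 → 𝒜 → EuclideanSpace ℝ (Fin d)) (z : 𝒳 × 𝒜) : EuclideanSpace ℝ (Fin d) :=
  WithLp.toLp 2 (invSqrt (B.featureCov μ φ) *ᵥ (featurePair φ z).ofLp)

/-- The vector `Σ^{1/2} w`, written as `Σ Σ^{-1/2} w`. -/
noncomputable def Bandit.colour (B : Bandit 𝒳 𝒜) (μ : Kernel 𝒳 𝒜)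
    (φ : 𝒳 → 𝒜 → EuclideanSpace ℝ (Fin d)) (w : EuclideanSpace ℝ (Fin d)) :
    EuclideanSpace ℝ (Fin d) :=
  WithLp.toLp 2 ((B.featureCov μ φ * invSqrt (B.featureCov μ φ)) *ᵥ w.ofLp)

lemma Bandit.inner_whitened (v : EuclideanSpace ℝ (Fin d)) (z : 𝒳 × 𝒜) :
    inner ℝ v (B.whitened μ φ z) =
      inner ℝ (featurePair φ z) (WithLp.toLp 2 (invSqrt (B.featureCov μ φ) *ᵥ v.ofLp)) := by
  rw [inner_eq_dotProduct, inner_eq_dotProduct, Bandit.whitened, Matrix.dotProduct_mulVec,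
    ← Matrix.mulVec_transpose, invSqrt_transpose, dotProduct_comm]

lemma Bandit.inner_colour_whitened (hpd : (B.featureCov μ φ).PosDef)
    (w : EuclideanSpace ℝ (Fin d)) (z : 𝒳 × 𝒜) :
    inner ℝ (B.colour μ φ w) (B.whitened μ φ z) = inner ℝ (featurePair φ z) w := by
  rw [Bandit.inner_whitened, Bandit.colour]
  simp only [Matrix.mulVec_mulVec]
  rw [← Matrix.mul_assoc, invSqrt_mul_mul_invSqrt hpd, Matrix.one_mulVec]

lemma Bandit.measurable_whitened (hφ : ∀ a, Measurable fun x => φ x a) :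
    Measurable (B.whitened μ φ) := by
  have := measurable_featurePair hφ
  have h : B.whitened μ φ = fun z => Matrix.toEuclideanCLM (n := Fin d) (𝕜 := ℝ)
      (invSqrt (B.featureCov μ φ)) (featurePair φ z) := by
    funext z; rfl
  rw [h]
  fun_prop

lemma Bandit.lintegral_exp_whitened_le (hφ : ∀ a, Measurable fun x => φ x a)
    (hwc : B.WellConditioned μ φ) {v : EuclideanSpace ℝ (Fin d)} (hv : ‖v‖ ≤ 1) {c : ℝ}
    (hc0 : 0 ≤ c) (hc : c ≤ 1 / 16) :
    ∫⁻ z, ENNReal.ofReal (Real.exp (c * inner ℝ v (B.whitened μ φ z) ^ 2))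
      ∂B.stateAction μ ≤ 2 := by
  have := B.measurable_whitened (μ := μ) hφ
  refine lintegral_exp_sq_le_two (by fun_prop) ?_ hc0 hc
  exact (le_iSup (fun v : {v : EuclideanSpace ℝ (Fin d) // ‖v‖ ≤ 1} =>
    psi2Norm (B.stateAction μ) fun z => inner ℝ (v : EuclideanSpace ℝ (Fin d))
      (B.whitened μ φ z)) ⟨v, hv⟩).trans hwc.2.2

lemma Bandit.memLp_whitened (hφ : ∀ a, Measurable fun x => φ x a)
    (hwc : B.WellConditioned μ φ) (v : EuclideanSpace ℝ (Fin d)) :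
    MemLp (fun z => inner ℝ v (B.whitened μ φ z)) 2 (B.stateAction μ) := by
  have hm := B.measurable_whitened (μ := μ) hφ
  rcases eq_or_ne v 0 with rfl | hv
  · simp
  have h1 : ‖(‖v‖⁻¹) • v‖ ≤ 1 := by
    rw [norm_smul, norm_inv, norm_norm, inv_mul_cancel₀ (norm_ne_zero_iff.2 hv)]
  have h2 := memLp_two_of_lintegral_exp_sq (by fun_prop) (by norm_num : (0 : ℝ) < 1 / 16)
    (B.lintegral_exp_whitened_le hφ hwc h1 (by norm_num) le_rfl)
  refine (h2.const_mul ‖v‖).ae_eq (ae_of_all _ fun z => ?_)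
  simp only [real_inner_smul_left]
  rw [mul_inv_cancel_left₀ (norm_ne_zero_iff.2 hv)]

lemma Bandit.memLp_inner_featurePair (hφ : ∀ a, Measurable fun x => φ x a)
    (hwc : B.WellConditioned μ φ) (w : EuclideanSpace ℝ (Fin d)) :
    MemLp (fun z => inner ℝ (featurePair φ z) w) 2 (B.stateAction μ) := by
  simp_rw [← B.inner_colour_whitened hwc.2.1]
  exact B.memLp_whitened hφ hwc _

lemma Bandit.memLp_featurePair_apply (hφ : ∀ a, Measurable fun x => φ x a)
    (hwc : B.WellConditioned μ φ) (i : Fin d) :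
    MemLp (fun z => featurePair φ z i) 2 (B.stateAction μ) := by
  simpa [EuclideanSpace.inner_single_right] using
    B.memLp_inner_featurePair hφ hwc (EuclideanSpace.single i 1)

lemma Bandit.integral_inner_mul_inner (hφ : ∀ a, Measurable fun x => φ x a)
    (hwc : B.WellConditioned μ φ) (v w : EuclideanSpace ℝ (Fin d)) :
    ∫ z, inner ℝ (featurePair φ z) v * inner ℝ (featurePair φ z) w ∂B.stateAction μ =
      v.ofLp ⬝ᵥ (B.featureCov μ φ *ᵥ w.ofLp) := by
  have hint : ∀ i j, Integrable (fun z => featurePair φ z i * featurePair φ z j)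
      (B.stateAction μ) := fun i j =>
    (B.memLp_featurePair_apply hφ hwc i).integrable_mul (B.memLp_featurePair_apply hφ hwc j)
  have h1 : ∀ z, inner ℝ (featurePair φ z) v * inner ℝ (featurePair φ z) w =
      ∑ i, ∑ j, (v i * w j) * (featurePair φ z i * featurePair φ z j) := by
    intro z
    rw [inner_eq_dotProduct, inner_eq_dotProduct, dotProduct, dotProduct, Finset.sum_mul_sum]
    exact Finset.sum_congr rfl fun i _ => Finset.sum_congr rfl fun j _ => by ring
  simp_rw [h1]
  rw [integral_finsetSum _ fun i _ => integrable_finsetSum _ fun j _ => (hint i j).const_mul _]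
  simp only [dotProduct, Matrix.mulVec, Finset.mul_sum]
  refine Finset.sum_congr rfl fun i _ => ?_
  rw [integral_finsetSum _ fun j _ => (hint i j).const_mul _]
  refine Finset.sum_congr rfl fun j _ => ?_
  rw [integral_const_mul, Bandit.featureCov, Matrix.of_apply]
  ring

/-- Whitened features are isotropic. -/
lemma Bandit.integral_whitened (hφ : ∀ a, Measurable fun x => φ x a)
    (hwc : B.WellConditioned μ φ) (u v : EuclideanSpace ℝ (Fin d)) :
    ∫ z, inner ℝ u (B.whitened μ φ z) * inner ℝ v (B.whitened μ φ z) ∂B.stateAction μ =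
      inner ℝ u v := by
  simp_rw [Bandit.inner_whitened]
  rw [B.integral_inner_mul_inner hφ hwc]
  simp only [Matrix.mulVec_mulVec]
  rw [dotProduct_comm, Matrix.dotProduct_mulVec, ← Matrix.mulVec_transpose, invSqrt_transpose,
    Matrix.mulVec_mulVec, ← Matrix.mul_assoc, invSqrt_mul_mul_invSqrt hwc.2.1, Matrix.one_mulVec,
    dotProduct_comm, inner_eq_dotProduct]

end Model

/-! ### The best linear fit -/

section BestFit

variable {𝒳 𝒜 : Type*} [MeasurableSpace 𝒳] [MeasurableSpace 𝒜] [MeasurableSingletonClass 𝒜]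
  [Finite 𝒜] {B : Bandit 𝒳 𝒜} {μ : Kernel 𝒳 𝒜} [IsMarkovKernel μ] {d : ℕ}
  {φ : 𝒳 → 𝒜 → EuclideanSpace ℝ (Fin d)}

/-- The minimiser `θ̄ = Σ⁻¹ E_μ [φ f]` of the mean squared error. -/
noncomputable def Bandit.bestFit (B : Bandit 𝒳 𝒜) (μ : Kernel 𝒳 𝒜)
    (φ : 𝒳 → 𝒜 → EuclideanSpace ℝ (Fin d)) : EuclideanSpace ℝ (Fin d) :=
  WithLp.toLp 2 ((B.featureCov μ φ)⁻¹ *ᵥ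
    fun i => ∫ z, featurePair φ z i * B.meanReward z.1 z.2 ∂B.stateAction μ)

lemma Bandit.ae_abs_meanReward_le (hreg : B.Regular) :
    ∀ᵐ z ∂B.stateAction μ, |B.meanReward z.1 z.2| ≤ 1 :=
  B.ae_stateAction_of_ae μ (p := fun x a => |B.meanReward x a| ≤ 1)
    (hreg.mono fun _ hx a => abs_le.2 (hx a).1)

lemma Bandit.memLp_meanReward (hreg : B.Regular) :
    MemLp (fun z : 𝒳 × 𝒜 => B.meanReward z.1 z.2) 2 (B.stateAction μ) :=
  MemLp.of_bound B.measurable_meanReward.aestronglyMeasurable 1 (B.ae_abs_meanReward_le hreg)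

lemma Bandit.memLp_misfit (hφ : ∀ a, Measurable fun x => φ x a) (hwc : B.WellConditioned μ φ)
    (hreg : B.Regular) (θ : EuclideanSpace ℝ (Fin d)) :
    MemLp (fun z => inner ℝ (featurePair φ z) θ - B.meanReward z.1 z.2) 2 (B.stateAction μ) :=
  (B.memLp_inner_featurePair hφ hwc θ).sub (B.memLp_meanReward hreg)

/-- Normal equations. -/
lemma Bandit.integral_inner_mul_misfit_bestFit (hφ : ∀ a, Measurable fun x => φ x a)
    (hwc : B.WellConditioned μ φ) (hreg : B.Regular) (v : EuclideanSpace ℝ (Fin d)) :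
    ∫ z, inner ℝ (featurePair φ z) v * (inner ℝ (featurePair φ z) (B.bestFit μ φ) -
      B.meanReward z.1 z.2) ∂B.stateAction μ = 0 := by
  have hf := B.memLp_meanReward (μ := μ) hreg
  have hv := B.memLp_inner_featurePair hφ hwc v
  have i1 : Integrable (fun z => inner ℝ (featurePair φ z) v *
      inner ℝ (featurePair φ z) (B.bestFit μ φ)) (B.stateAction μ) :=
    hv.integrable_mul (B.memLp_inner_featurePair hφ hwc _)
  have i2 : Integrable (fun z => inner ℝ (featurePair φ z) v * B.meanReward z.1 z.2)
      (B.stateAction μ) := hv.integrable_mul hf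
  simp_rw [mul_sub]
  rw [integral_sub i1 i2, B.integral_inner_mul_inner hφ hwc, Bandit.bestFit,
    mulVec_inv_mulVec hwc.2.1, sub_eq_zero]
  have h1 : ∀ z : 𝒳 × 𝒜, inner ℝ (featurePair φ z) v * B.meanReward z.1 z.2 =
      ∑ i, v i * (featurePair φ z i * B.meanReward z.1 z.2) := by
    intro z
    rw [inner_eq_dotProduct, dotProduct, Finset.sum_mul]
    exact Finset.sum_congr rfl fun i _ => by ring
  have i3 : ∀ i, Integrable (fun z => featurePair φ z i * B.meanReward z.1 z.2)
      (B.stateAction μ) := fun i => (B.memLp_featurePair_apply hφ hwc i).integrable_mul hf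
  simp_rw [h1]
  rw [integral_finsetSum _ fun i _ => (i3 i).const_mul _]
  simp only [dotProduct, integral_const_mul]

lemma Bandit.meanSqError_bestFit_le (hφ : ∀ a, Measurable fun x => φ x a)
    (hwc : B.WellConditioned μ φ) (hreg : B.Regular) (θ : EuclideanSpace ℝ (Fin d)) :
    B.meanSqError μ φ (B.bestFit μ φ) ≤ B.meanSqError μ φ θ := by
  set b := B.bestFit μ φ
  have hb := B.memLp_misfit hφ hwc hreg b
  have hw := B.memLp_inner_featurePair hφ hwc (θ - b)
  have i1 := (memLp_two_iff_integrable_sq hb.aestronglyMeasurable).1 hb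
  have i2 := (memLp_two_iff_integrable_sq hw.aestronglyMeasurable).1 hw
  have i3 : Integrable (fun z => inner ℝ (featurePair φ z) (θ - b) *
      (inner ℝ (featurePair φ z) b - B.meanReward z.1 z.2)) (B.stateAction μ) :=
    hw.integrable_mul hb
  have h1 : ∀ z : 𝒳 × 𝒜, (inner ℝ (featurePair φ z) θ - B.meanReward z.1 z.2) ^ 2 =
      (inner ℝ (featurePair φ z) b - B.meanReward z.1 z.2) ^ 2 +
      2 * (inner ℝ (featurePair φ z) (θ - b) *
        (inner ℝ (featurePair φ z) b - B.meanReward z.1 z.2)) +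
      inner ℝ (featurePair φ z) (θ - b) ^ 2 := by
    intro z; rw [inner_sub_right]; ring
  have i4 : Integrable (fun z => (inner ℝ (featurePair φ z) b - B.meanReward z.1 z.2) ^ 2 +
      2 * (inner ℝ (featurePair φ z) (θ - b) *
        (inner ℝ (featurePair φ z) b - B.meanReward z.1 z.2))) (B.stateAction μ) :=
    i1.add (i3.const_mul 2)
  unfold Bandit.meanSqError
  simp_rw [h1]
  rw [integral_add i4 i2, integral_add i1 (i3.const_mul 2), integral_const_mul,
    B.integral_inner_mul_misfit_bestFit hφ hwc hreg]
  have : 0 ≤ ∫ z, inner ℝ (featurePair φ z) (θ - b) ^ 2 ∂B.stateAction μ :=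
    integral_nonneg fun z => sq_nonneg _
  linarith

lemma Bandit.approxError_eq (hφ : ∀ a, Measurable fun x => φ x a)
    (hwc : B.WellConditioned μ φ) (hreg : B.Regular) :
    B.approxError μ φ =
      2 * √((concentrability μ).toReal * B.meanSqError μ φ (B.bestFit μ φ)) := by
  refine le_antisymm (ciInf_le ⟨0, ?_⟩ _) (le_ciInf fun θ => ?_)
  · rintro _ ⟨θ, rfl⟩
    positivity
  · have := B.meanSqError_bestFit_le hφ hwc hreg θ
    gcongr

/-- The best fit is a projection of `f` in `L²`, so `‖Σ^{1/2} θ̄‖² = E ⟨φ, θ̄⟩² ≤ E f² ≤ 1`. -/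
lemma Bandit.norm_colour_bestFit_le (hφ : ∀ a, Measurable fun x => φ x a)
    (hwc : B.WellConditioned μ φ) (hreg : B.Regular) :
    ‖B.colour μ φ (B.bestFit μ φ)‖ ≤ 1 := by
  set b := B.bestFit μ φ
  have hb := B.memLp_misfit hφ hwc hreg b
  have hp := B.memLp_inner_featurePair hφ hwc b
  have hf := B.memLp_meanReward (μ := μ) hreg
  have i1 := (memLp_two_iff_integrable_sq hb.aestronglyMeasurable).1 hb
  have i2 := (memLp_two_iff_integrable_sq hp.aestronglyMeasurable).1 hp
  have i3 : Integrable (fun z => inner ℝ (featurePair φ z) b *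
      (inner ℝ (featurePair φ z) b - B.meanReward z.1 z.2)) (B.stateAction μ) :=
    hp.integrable_mul hb
  have h1 : ‖B.colour μ φ b‖ ^ 2 = ∫ z, inner ℝ (featurePair φ z) b ^ 2 ∂B.stateAction μ := by
    rw [← real_inner_self_eq_norm_sq, ← B.integral_whitened hφ hwc]
    simp_rw [B.inner_colour_whitened hwc.2.1, sq]
  have h2 : ∀ z : 𝒳 × 𝒜, inner ℝ (featurePair φ z) b ^ 2 =
      B.meanReward z.1 z.2 ^ 2 - (inner ℝ (featurePair φ z) b - B.meanReward z.1 z.2) ^ 2 +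
      2 * (inner ℝ (featurePair φ z) b *
        (inner ℝ (featurePair φ z) b - B.meanReward z.1 z.2)) := fun z => by ring
  have i4 := (memLp_two_iff_integrable_sq hf.aestronglyMeasurable).1 hf
  have i5 : Integrable (fun z : 𝒳 × 𝒜 => B.meanReward z.1 z.2 ^ 2 -
      (inner ℝ (featurePair φ z) b - B.meanReward z.1 z.2) ^ 2) (B.stateAction μ) := i4.sub i1
  have h3 : ∫ z, inner ℝ (featurePair φ z) b ^ 2 ∂B.stateAction μ ≤ 1 := by
    simp_rw [h2]
    rw [integral_add i5 (i3.const_mul 2), integral_sub i4 i1, integral_const_mul,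
      B.integral_inner_mul_misfit_bestFit hφ hwc hreg]
    have h5 : ∫ z : 𝒳 × 𝒜, B.meanReward z.1 z.2 ^ 2 ∂B.stateAction μ ≤ 1 := by
      refine (integral_mono_ae i4 (integrable_const 1)
        ((B.ae_abs_meanReward_le hreg).mono fun z hz => ?_)).trans (by simp)
      exact (sq_le_one_iff_abs_le_one _).2 hz
    have h6 : 0 ≤ ∫ z, (inner ℝ (featurePair φ z) b - B.meanReward z.1 z.2) ^ 2
        ∂B.stateAction μ := integral_nonneg fun z => sq_nonneg _
    linarith
  rw [← h1] at h3
  nlinarith [norm_nonneg (B.colour μ φ b)]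

/-! ### Estimation error of the ridge estimate -/

/-- The residual `y - ⟨φ(x, a), θ̄⟩` of a recorded interaction. -/
noncomputable def Bandit.residual (B : Bandit 𝒳 𝒜) (μ : Kernel 𝒳 𝒜)
    (φ : 𝒳 → 𝒜 → EuclideanSpace ℝ (Fin d)) (z : 𝒳 × 𝒜 × ℝ) : ℝ :=
  z.2.2 - inner ℝ (featurePair φ (z.1, z.2.1)) (B.bestFit μ φ)

lemma Bandit.measurable_noise (B : Bandit 𝒳 𝒜) :
    Measurable fun z : 𝒳 × 𝒜 × ℝ => z.2.2 - B.meanReward z.1 z.2.1 := by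
  have h1 : Measurable fun z : 𝒳 × 𝒜 × ℝ => (z.1, z.2.1) := by fun_prop
  exact measurable_snd.snd.sub (B.measurable_meanReward.comp h1)

lemma Bandit.measurable_residual (hφ : ∀ a, Measurable fun x => φ x a) :
    Measurable (B.residual μ φ) := by
  have h1 : Measurable fun z : 𝒳 × 𝒜 × ℝ => (z.1, z.2.1) := by fun_prop
  have h2 : Measurable fun z : 𝒳 × 𝒜 × ℝ => featurePair φ (z.1, z.2.1) :=
    (measurable_featurePair hφ).comp h1
  unfold Bandit.residual
  fun_prop

lemma Bandit.lintegral_exp_noise_le (hreg : B.Regular) :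
    ∫⁻ z, ENNReal.ofReal (Real.exp (1 / 16 * (z.2.2 - B.meanReward z.1 z.2.1) ^ 2))
      ∂B.sampleLaw μ ≤ 2 := by
  have hm := B.measurable_noise
  rw [B.lintegral_sampleLaw μ (by fun_prop)]
  have h1 : ∀ᵐ x ∂B.stateLaw, ∫⁻ a, ∫⁻ y, ENNReal.ofReal (Real.exp
      (1 / 16 * (y a - B.meanReward x a) ^ 2)) ∂B.rewardLaw x ∂μ x ≤ 2 := by
    refine hreg.mono fun x hx => ?_
    calc _ ≤ ∫⁻ _a, 2 ∂μ x := lintegral_mono fun a =>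
          lintegral_exp_sq_le_two ((measurable_pi_apply a).sub_const _) (hx a).2 (by norm_num)
            le_rfl
      _ = 2 := by simp
  calc _ ≤ ∫⁻ _x, 2 ∂B.stateLaw := lintegral_mono_ae h1
    _ = 2 := by simp

lemma Bandit.residual_eq (z : 𝒳 × 𝒜 × ℝ) : B.residual μ φ z =
    (z.2.2 - B.meanReward z.1 z.2.1) + B.meanReward z.1 z.2.1 +
      -inner ℝ (featurePair φ (z.1, z.2.1)) (B.bestFit μ φ) := by
  rw [Bandit.residual]; ring

/-- The residual is a sum of three sub-Gaussian terms: noise, mean reward and best fit. -/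
lemma Bandit.lintegral_exp_residual_le (hφ : ∀ a, Measurable fun x => φ x a)
    (hwc : B.WellConditioned μ φ) (hreg : B.Regular) :
    ∫⁻ z, ENNReal.ofReal (Real.exp (1 / 144 * B.residual μ φ z ^ 2)) ∂B.sampleLaw μ ≤ 2 := by
  have hmp := B.measurePreserving_stateAction μ
  have hnoise := B.lintegral_exp_noise_le (μ := μ) hreg
  have hn := B.measurable_noise
  have hmean := B.measurable_meanReward
  have hfeat := measurable_featurePair hφ
  have hmean' : Measurable fun z : 𝒳 × 𝒜 × ℝ => B.meanReward z.1 z.2.1 := hmean.comp hmp.1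
  have hfeat' : Measurable fun z : 𝒳 × 𝒜 × ℝ => featurePair φ (z.1, z.2.1) := hfeat.comp hmp.1
  have hrew : ∫⁻ z, ENNReal.ofReal (Real.exp (1 / 16 * B.meanReward z.1 z.2.1 ^ 2))
      ∂B.sampleLaw μ ≤ 2 := by
    rw [hmp.lintegral_comp (f := fun z => ENNReal.ofReal (Real.exp
      (1 / 16 * B.meanReward z.1 z.2 ^ 2))) (by fun_prop)]
    calc _ ≤ ∫⁻ _z, 2 ∂B.stateAction μ :=
          lintegral_mono_ae ((B.ae_abs_meanReward_le hreg).mono fun z hz => by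
            have h1 := (sq_le_one_iff_abs_le_one _).2 hz
            have h2 : Real.exp (1 / 16 * B.meanReward z.1 z.2 ^ 2) ≤ Real.exp (Real.log 2) := by
              rw [Real.exp_le_exp]
              linarith [Real.log_two_gt_d9]
            rw [Real.exp_log two_pos] at h2
            exact (ENNReal.ofReal_le_ofReal h2).trans (by simp))
      _ = 2 := by simp
  have hfit : ∫⁻ z, ENNReal.ofReal (Real.exp (1 / 16 *
      (-inner ℝ (featurePair φ (z.1, z.2.1)) (B.bestFit μ φ)) ^ 2)) ∂B.sampleLaw μ ≤ 2 := by
    rw [hmp.lintegral_comp (f := fun z => ENNReal.ofReal (Real.exp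
      (1 / 16 * (-inner ℝ (featurePair φ z) (B.bestFit μ φ)) ^ 2))) (by fun_prop)]
    simp_rw [neg_sq, ← B.inner_colour_whitened hwc.2.1]
    exact B.lintegral_exp_whitened_le hφ hwc (B.norm_colour_bestFit_le hφ hwc hreg)
      (by norm_num) le_rfl
  have hpt : ∀ z : 𝒳 × 𝒜 × ℝ, ENNReal.ofReal (Real.exp (1 / 144 * B.residual μ φ z ^ 2)) ≤
      3⁻¹ * (ENNReal.ofReal (Real.exp (1 / 16 * (z.2.2 - B.meanReward z.1 z.2.1) ^ 2)) +
        ENNReal.ofReal (Real.exp (1 / 16 * B.meanReward z.1 z.2.1 ^ 2)) +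
        ENNReal.ofReal (Real.exp (1 / 16 *
          (-inner ℝ (featurePair φ (z.1, z.2.1)) (B.bestFit μ φ)) ^ 2))) := by
    intro z
    rw [← ENNReal.ofReal_add (Real.exp_pos _).le (Real.exp_pos _).le,
      ← ENNReal.ofReal_add (add_pos (Real.exp_pos _) (Real.exp_pos _)).le (Real.exp_pos _).le,
      show (3 : ℝ≥0∞)⁻¹ = ENNReal.ofReal 3⁻¹ by
        rw [ENNReal.ofReal_inv_of_pos (by norm_num), ENNReal.ofReal_ofNat],
      ← ENNReal.ofReal_mul (by norm_num)]
    refine ENNReal.ofReal_le_ofReal ?_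
    have := exp_sq_add_add_le (c := 1 / 144) (by norm_num) (z.2.2 - B.meanReward z.1 z.2.1)
      (B.meanReward z.1 z.2.1) (-inner ℝ (featurePair φ (z.1, z.2.1)) (B.bestFit μ φ))
    rw [← B.residual_eq, show (9 : ℝ) * (1 / 144) = 1 / 16 by norm_num] at this
    linarith
  calc _ ≤ _ := lintegral_mono hpt
    _ ≤ 3⁻¹ * (2 + 2 + 2) := by
        rw [lintegral_const_mul _ (by fun_prop), lintegral_add_left (by fun_prop),
          lintegral_add_left (by fun_prop)]
        gcongr
    _ = 2 := by
        rw [show (2 + 2 + 2 : ℝ≥0∞) = 3 * 2 by norm_num, ← mul_assoc,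
          ENNReal.inv_mul_cancel (by norm_num) (by norm_num), one_mul]

/-- Residuals are uncorrelated with the features: the noise by conditioning, the misspecification by
the normal equations. -/
lemma Bandit.integral_inner_mul_residual (hφ : ∀ a, Measurable fun x => φ x a)
    (hwc : B.WellConditioned μ φ) (hreg : B.Regular) (v : EuclideanSpace ℝ (Fin d)) :
    ∫ z, inner ℝ (featurePair φ (z.1, z.2.1)) v * B.residual μ φ z ∂B.sampleLaw μ = 0 := by
  have hmp := B.measurePreserving_stateAction μ
  have hv := B.memLp_inner_featurePair hφ hwc v
  have hv' : MemLp (fun z : 𝒳 × 𝒜 × ℝ => inner ℝ (featurePair φ (z.1, z.2.1)) v) 2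
      (B.sampleLaw μ) := hv.comp_measurePreserving hmp
  have hnoise := memLp_two_of_lintegral_exp_sq B.measurable_noise (by norm_num)
    (B.lintegral_exp_noise_le (μ := μ) hreg)
  have hmf := B.memLp_misfit hφ hwc hreg (B.bestFit μ φ)
  have i1 : Integrable (fun z : 𝒳 × 𝒜 × ℝ => inner ℝ (featurePair φ (z.1, z.2.1)) v *
      (z.2.2 - B.meanReward z.1 z.2.1)) (B.sampleLaw μ) := hv'.integrable_mul hnoise
  have i2 : Integrable (fun z : 𝒳 × 𝒜 => inner ℝ (featurePair φ z) v *
      (inner ℝ (featurePair φ z) (B.bestFit μ φ) - B.meanReward z.1 z.2)) (B.stateAction μ) :=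
    hv.integrable_mul hmf
  have i3 : Integrable (fun z : 𝒳 × 𝒜 × ℝ => inner ℝ (featurePair φ (z.1, z.2.1)) v *
      (inner ℝ (featurePair φ (z.1, z.2.1)) (B.bestFit μ φ) - B.meanReward z.1 z.2.1))
      (B.sampleLaw μ) := hmp.integrable_comp_of_integrable i2
  have h1 : ∀ z : 𝒳 × 𝒜 × ℝ, inner ℝ (featurePair φ (z.1, z.2.1)) v * B.residual μ φ z =
      inner ℝ (featurePair φ (z.1, z.2.1)) v * (z.2.2 - B.meanReward z.1 z.2.1) -
      inner ℝ (featurePair φ (z.1, z.2.1)) v *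
      (inner ℝ (featurePair φ (z.1, z.2.1)) (B.bestFit μ φ) - B.meanReward z.1 z.2.1) := fun z => by
    rw [Bandit.residual]; ring
  have hmfeat := measurable_featurePair hφ
  have h2 : ∫ z : 𝒳 × 𝒜 × ℝ, inner ℝ (featurePair φ (z.1, z.2.1)) v *
      (inner ℝ (featurePair φ (z.1, z.2.1)) (B.bestFit μ φ) - B.meanReward z.1 z.2.1)
      ∂B.sampleLaw μ = 0 := by
    rw [← B.integral_inner_mul_misfit_bestFit hφ hwc hreg v, ← hmp.map_eq,
      integral_map hmp.1.aemeasurable]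
    rw [hmp.map_eq]
    exact i2.aestronglyMeasurable
  simp_rw [h1]
  rw [integral_sub i1 i3, h2, sub_zero]
  exact B.integral_mul_noise_eq_zero μ (g := fun z => inner ℝ (featurePair φ z) v)
    (by fun_prop) i1

/-- The numerical factor `16385 / c³` of the self-normalised bound for `c = 1 / 144`, which is
the admissible exponent `1 / 16` of each of the three summands of the residual divided by `3²`. -/
noncomputable def errorConst : ℝ := 16385 / (1 / 144) ^ 3

/-- The self-normalised bound for the features, deduced from the one for the whitened features by
the change of variables `u = Σ^{1/2} w`. -/
lemma Bandit.dataLaw_not_selfNormalised_le (n : ℕ) (hφ : ∀ a, Measurable fun x => φ x a)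
    (hwc : B.WellConditioned μ φ) (hreg : B.Regular) {L : ℝ} (hL : 0 ≤ L) :
    B.dataLaw μ n {D | ¬ ∀ w : EuclideanSpace ℝ (Fin d),
      (∑ i, inner ℝ (φ (D i).1 (D i).2.1) w *
        ((D i).2.2 - inner ℝ (φ (D i).1 (D i).2.1) (B.bestFit μ φ))) ^ 2 ≤
      errorConst * (d + L) * ∑ i, inner ℝ (φ (D i).1 (D i).2.1) w ^ 2} ≤
      4 * ENNReal.ofReal (Real.exp (-L)) := by
  have hmp := B.measurePreserving_stateAction μ
  have hw := B.measurable_whitened (μ := μ) hφ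
  have key := measure_pi_not_selfNormalised_le (B.sampleLaw μ) n
    (Z := fun z => B.whitened μ φ (z.1, z.2.1)) (r := B.residual μ φ) (c := 1 / 144)
    (hw.comp hmp.1) (B.measurable_residual hφ) (by norm_num) (by norm_num)
    (fun v hv => by
      rw [hmp.lintegral_comp (f := fun z => ENNReal.ofReal (Real.exp
        (1 / 144 * inner ℝ v (B.whitened μ φ z) ^ 2))) (by fun_prop)]
      exact B.lintegral_exp_whitened_le hφ hwc hv (by norm_num) (by norm_num))
    (B.lintegral_exp_residual_le hφ hwc hreg)
    (fun u v => by
      rw [← B.integral_whitened hφ hwc, ← hmp.map_eq, integral_map hmp.1.aemeasurable]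
      fun_prop)
    (fun v => by
      simp_rw [B.inner_whitened]
      exact B.integral_inner_mul_residual hφ hwc hreg _) hL
  refine (measure_mono ?_).trans key
  intro D hD hcon
  refine hD fun w => ?_
  have h := hcon (B.colour μ φ w)
  simp_rw [B.inner_colour_whitened hwc.2.1] at h
  exact h

end BestFit

/-! ### Accuracy of the value estimates -/

section Value

variable {𝒳 𝒜 : Type*} [MeasurableSpace 𝒳] [MeasurableSpace 𝒜] [MeasurableSingletonClass 𝒜]
  [Fintype 𝒜] [Nonempty 𝒜] {B : Bandit 𝒳 𝒜} {μ : Kernel 𝒳 𝒜} [IsMarkovKernel μ] {d e n : ℕ}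
  {φ : 𝒳 → 𝒜 → EuclideanSpace ℝ (Fin d)} {ψ : 𝒳 → 𝒜 → EuclideanSpace ℝ (Fin e)}

lemma Policy.measurable_graph (π : Policy 𝒳 𝒜) : Measurable fun x => (x, π.1 x) :=
  measurable_id.prodMk π.2

lemma Bandit.integrable_policy (hC : concentrability μ ≠ ∞) (π : Policy 𝒳 𝒜) {g : 𝒳 × 𝒜 → ℝ}
    (hg : Measurable g) (hint : Integrable g (B.stateAction μ)) :
    Integrable (fun x => g (x, π.1 x)) B.stateLaw := by
  refine ⟨(hg.comp π.measurable_graph).aestronglyMeasurable, ?_⟩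
  refine (lintegral_policy_le hC π.1 (g := fun z => ‖g z‖ₑ) (by fun_prop)).trans_lt ?_
  exact ENNReal.mul_lt_top hC.lt_top hint.2

lemma Bandit.integral_policy_le (hC : concentrability μ ≠ ∞) (π : Policy 𝒳 𝒜) {g : 𝒳 × 𝒜 → ℝ}
    (hg : Measurable g) (hg0 : 0 ≤ g) (hint : Integrable g (B.stateAction μ)) :
    ∫ x, g (x, π.1 x) ∂B.stateLaw ≤
      (concentrability μ).toReal * ∫ z, g z ∂B.stateAction μ := by
  have h := lintegral_policy_le (B := B) hC π.1 (g := fun z => ENNReal.ofReal (g z)) (by fun_prop)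
  rw [← ofReal_integral_eq_lintegral_ofReal hint (ae_of_all _ hg0),
    ← ofReal_integral_eq_lintegral_ofReal (B.integrable_policy hC π hg hint)
      (ae_of_all _ fun x => hg0 _), ← ENNReal.ofReal_toReal hC,
    ← ENNReal.ofReal_mul ENNReal.toReal_nonneg] at h
  rwa [ENNReal.ofReal_le_ofReal_iff
    (mul_nonneg ENNReal.toReal_nonneg (integral_nonneg hg0))] at h

lemma Bandit.integrable_inner_policy (hC : concentrability μ ≠ ∞)
    (hφ : ∀ a, Measurable fun x => φ x a) (hwc : B.WellConditioned μ φ) (π : Policy 𝒳 𝒜)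
    (w : EuclideanSpace ℝ (Fin d)) :
    Integrable (fun x => inner ℝ (φ x (π.1 x)) w) B.stateLaw := by
  have hm := measurable_featurePair hφ
  exact B.integrable_policy hC π (g := fun z => inner ℝ (featurePair φ z) w) (by fun_prop)
    ((B.memLp_inner_featurePair hφ hwc w).integrable (by norm_num))

lemma Bandit.integrable_meanReward_policy (hreg : B.Regular) (π : Policy 𝒳 𝒜) :
    Integrable (fun x => B.meanReward x (π.1 x)) B.stateLaw :=
  Integrable.of_bound (B.measurable_meanReward.comp π.measurable_graph).aestronglyMeasurable 1
    (hreg.mono fun _ hx => abs_le.2 (hx _).1)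

lemma Bandit.integrable_mahalanobis (hC : concentrability μ ≠ ∞)
    (hφ : ∀ a, Measurable fun x => φ x a) (hwc : B.WellConditioned μ φ)
    {V : Matrix (Fin d) (Fin d) ℝ} (hV : V.PosDef) (a : 𝒜) :
    Integrable (fun x => mahalanobis V⁻¹ (φ x a)) B.stateLaw := by
  have hm := measurable_featurePair hφ
  have hint : Integrable (featurePair φ) (B.stateAction μ) := Integrable.of_eval_piLp fun i =>
    (B.memLp_featurePair_apply hφ hwc i).integrable (by norm_num)
  simp_rw [← norm_toEuclideanCLM_invSqrt hV]
  exact B.integrable_policy hC ⟨fun _ => a, measurable_const⟩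
    (g := fun z => ‖Matrix.toEuclideanCLM (n := Fin d) (𝕜 := ℝ) (invSqrt V) (featurePair φ z)‖)
    (by fun_prop) (ContinuousLinearMap.integrable_comp _ hint).norm

lemma le_iSup_mahalanobis (S : Matrix (Fin d) (Fin d) ℝ) (x : 𝒳) (a : 𝒜) :
    mahalanobis S (φ x a) ≤ ⨆ a : 𝒜, mahalanobis S (φ x a) :=
  le_ciSup (f := fun a => mahalanobis S (φ x a)) (Set.finite_range _).bddAbove a

lemma Bandit.integrable_iSup_mahalanobis (hC : concentrability μ ≠ ∞)
    (hφ : ∀ a, Measurable fun x => φ x a) (hwc : B.WellConditioned μ φ)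
    {V : Matrix (Fin d) (Fin d) ℝ} (hV : V.PosDef) :
    Integrable (fun x => ⨆ a : 𝒜, mahalanobis V⁻¹ (φ x a)) B.stateLaw := by
  have hm : ∀ a, Measurable fun x => mahalanobis V⁻¹ (φ x a) := fun a => by
    simp_rw [← norm_toEuclideanCLM_invSqrt hV]
    have := hφ a
    fun_prop
  refine Integrable.mono' (integrable_finsetSum Finset.univ fun a _ =>
    B.integrable_mahalanobis hC hφ hwc hV a) (Measurable.iSup hm).aestronglyMeasurable
    (ae_of_all _ fun x => ?_)
  rw [Real.norm_of_nonneg (Real.iSup_nonneg fun a => mahalanobis_nonneg _ _)]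
  exact ciSup_le fun a => Finset.single_le_sum (f := fun a => mahalanobis V⁻¹ (φ x a))
    (fun a _ => mahalanobis_nonneg _ _) (Finset.mem_univ a)

/-- The value `E_X f(X, π(X))` of a policy. -/
noncomputable def Bandit.value (B : Bandit 𝒳 𝒜) (π : Policy 𝒳 𝒜) : ℝ :=
  ∫ x, B.meanReward x (π.1 x) ∂B.stateLaw

lemma Bandit.regret_eq (hreg : B.Regular) (π π' : Policy 𝒳 𝒜) :
    B.regret π π' = B.value π - B.value π' :=
  integral_sub (B.integrable_meanReward_policy hreg π) (B.integrable_meanReward_policy hreg π')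

/-- The bias of the best fit, uniformly over policies. -/
lemma Bandit.abs_integral_misfit_le (hC : concentrability μ ≠ ∞)
    (hφ : ∀ a, Measurable fun x => φ x a) (hwc : B.WellConditioned μ φ) (hreg : B.Regular)
    (π : Policy 𝒳 𝒜) :
    |∫ x, (inner ℝ (φ x (π.1 x)) (B.bestFit μ φ) - B.meanReward x (π.1 x)) ∂B.stateLaw| ≤
      B.approxError μ φ / 2 := by
  rw [B.approxError_eq hφ hwc hreg, mul_div_cancel_left₀ _ two_ne_zero]
  refine Real.abs_le_sqrt ?_
  have hm := measurable_featurePair hφ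
  have hf := B.measurable_meanReward
  have hmis := B.memLp_misfit hφ hwc hreg (B.bestFit μ φ)
  have hsq := (memLp_two_iff_integrable_sq hmis.aestronglyMeasurable).1 hmis
  have hmeas : Measurable fun z : 𝒳 × 𝒜 =>
    inner ℝ (featurePair φ z) (B.bestFit μ φ) - B.meanReward z.1 z.2 := by fun_prop
  have hsq' := B.integrable_policy hC π (hmeas.pow_const 2) hsq
  have hL2 : MemLp (fun x => inner ℝ (φ x (π.1 x)) (B.bestFit μ φ) - B.meanReward x (π.1 x)) 2
      B.stateLaw :=
    (memLp_two_iff_integrable_sq (hmeas.comp π.measurable_graph).aestronglyMeasurable).2 hsq'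
  have hvar := variance_nonneg
    (fun x => inner ℝ (φ x (π.1 x)) (B.bestFit μ φ) - B.meanReward x (π.1 x)) B.stateLaw
  rw [variance_eq_sub hL2] at hvar
  have := B.integral_policy_le hC π (hmeas.pow_const 2) (fun z => sq_nonneg _) hsq
  simp only [Pi.pow_apply] at hvar
  rw [Bandit.meanSqError]
  exact (sub_nonneg.1 hvar).trans this

/-- Value estimates are accurate, uniformly over policies, as soon as the parameter estimate is
accurate in the norm of `V`. -/
lemma Bandit.abs_valueEst_sub_value_le (hC : concentrability μ ≠ ∞)
    (hφ : ∀ a, Measurable fun x => φ x a) (hwc : B.WellConditioned μ φ) (hreg : B.Regular)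
    (hn : 0 < n) (D : Dataset 𝒳 𝒜 n) {ζ : ℝ}
    (hζ : √((ridge 1 φ D - B.bestFit μ φ).ofLp ⬝ᵥ
      (empCov 1 φ D *ᵥ (ridge 1 φ D - B.bestFit μ φ).ofLp)) ≤ ζ) (π : Policy 𝒳 𝒜) :
    |B.valueEst 1 φ D π - B.value π| ≤ ζ * B.coverage 1 φ D + B.approxError μ φ / 2 := by
  set w := ridge 1 φ D - B.bestFit μ φ with hw
  have hV := empCov_posDef one_pos hn φ D
  have i1 := B.integrable_inner_policy hC hφ hwc π (ridge 1 φ D)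
  have i2 := B.integrable_inner_policy hC hφ hwc π (B.bestFit μ φ)
  have i3 := B.integrable_meanReward_policy hreg π
  have i4 := B.integrable_inner_policy hC hφ hwc π w
  have i5 := B.integrable_iSup_mahalanobis hC hφ hwc hV
  have hdec : B.valueEst 1 φ D π - B.value π = ∫ x, inner ℝ (φ x (π.1 x)) w ∂B.stateLaw +
      ∫ x, (inner ℝ (φ x (π.1 x)) (B.bestFit μ φ) - B.meanReward x (π.1 x)) ∂B.stateLaw := by
    have i6 : Integrable (fun x => inner ℝ (φ x (π.1 x)) (B.bestFit μ φ) -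
      B.meanReward x (π.1 x)) B.stateLaw := i2.sub i3
    rw [Bandit.valueEst, Bandit.value, ← integral_add i4 i6]
    unfold fitted
    rw [← integral_sub i1 i3]
    refine integral_congr_ae (ae_of_all _ fun x => ?_)
    simp only [hw, inner_sub_right]
    ring
  have h1 : |∫ x, inner ℝ (φ x (π.1 x)) w ∂B.stateLaw| ≤ ζ * B.coverage 1 φ D := by
    rw [Bandit.coverage, ← integral_const_mul]
    refine abs_integral_le_integral_abs.trans (integral_mono i4.abs (i5.const_mul ζ) fun x => ?_)
    rw [inner_eq_dotProduct]
    refine (abs_dotProduct_le_mahalanobis_mul hV _ _).trans ?_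
    rw [mul_comm]
    exact mul_le_mul hζ (le_iSup_mahalanobis _ x _) (mahalanobis_nonneg _ _)
      ((Real.sqrt_nonneg _).trans hζ)
  rw [hdec]
  exact (abs_add_le _ _).trans (add_le_add h1 (B.abs_integral_misfit_le hC hφ hwc hreg π))

/-- A greedy policy maximises the estimated value. -/
lemma Bandit.valueEst_le_of_greedy (hC : concentrability μ ≠ ∞)
    (hφ : ∀ a, Measurable fun x => φ x a) (hwc : B.WellConditioned μ φ) (D : Dataset 𝒳 𝒜 n)
    (lam : ℝ) {π' : Policy 𝒳 𝒜} (h : ∀ x a, fitted lam φ D x a ≤ fitted lam φ D x (π'.1 x))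
    (π : Policy 𝒳 𝒜) : B.valueEst lam φ D π ≤ B.valueEst lam φ D π' :=
  integral_mono (B.integrable_inner_policy hC hφ hwc π _)
    (B.integrable_inner_policy hC hφ hwc π' _) fun x => h x _

/-! ### Monotonicity along nested classes -/

lemma Bandit.coverage_nonneg (lam : ℝ) (D : Dataset 𝒳 𝒜 n) : 0 ≤ B.coverage lam φ D :=
  integral_nonneg fun _ => Real.iSup_nonneg fun _ => mahalanobis_nonneg _ _

lemma Bandit.coverage_mono (hC : concentrability μ ≠ ∞) (hφψ : IsPrefix φ ψ)
    (hψ : ∀ a, Measurable fun x => ψ x a) (hwc : B.WellConditioned μ ψ) (hn : 0 < n) {lam : ℝ}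
    (hlam : 0 < lam) (D : Dataset 𝒳 𝒜 n) : B.coverage lam φ D ≤ B.coverage lam ψ D := by
  obtain ⟨h, hres⟩ := hφψ
  refine integral_mono_of_nonneg
    (ae_of_all _ fun x => Real.iSup_nonneg fun a => mahalanobis_nonneg _ _)
    (B.integrable_iSup_mahalanobis hC hψ hwc (empCov_posDef hlam hn ψ D))
    (ae_of_all _ fun x => ciSup_le fun a => ?_)
  refine le_trans ?_ (le_iSup_mahalanobis _ x a)
  rw [← hres x a]
  exact mahalanobis_restrictFirst_le h hres hlam hn D _

lemma Bandit.approxError_anti (hφψ : IsPrefix φ ψ) (hφ : ∀ a, Measurable fun x => φ x a)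
    (hwφ : B.WellConditioned μ φ) (hψ : ∀ a, Measurable fun x => ψ x a)
    (hwψ : B.WellConditioned μ ψ) (hreg : B.Regular) :
    B.approxError μ ψ ≤ B.approxError μ φ := by
  obtain ⟨h, hres⟩ := hφψ
  rw [B.approxError_eq hφ hwφ hreg, B.approxError_eq hψ hwψ hreg]
  have h1 : B.meanSqError μ φ (B.bestFit μ φ) =
      B.meanSqError μ ψ (extendZero e (B.bestFit μ φ)) := by
    unfold Bandit.meanSqError featurePair
    simp_rw [inner_eq_dotProduct, dotProduct_extendZero h, hres]
  have h2 := B.meanSqError_bestFit_le hψ hwψ hreg (extendZero e (B.bestFit μ φ))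
  rw [h1]
  gcongr

section Zeta

variable {C₁ C₂ C₃ C₄ δ : ℝ}

lemma log_four_mul_div_nonneg (hd : 0 < d) (hδ : 0 < δ) (hδ1 : δ ≤ 1) :
    0 ≤ Real.log (4 * d / δ) := by
  have : (1 : ℝ) ≤ d := by exact_mod_cast hd
  refine Real.log_nonneg ?_
  rw [le_div_iff₀ hδ]
  linarith

lemma zeta_nonneg (h₁ : 0 ≤ C₁) (hd : 0 < d) (hδ : 0 < δ) (hδ1 : δ ≤ 1) (lam : ℝ)
    (D : Dataset 𝒳 𝒜 n) : 0 ≤ zeta C₁ C₂ C₃ C₄ lam φ D δ := by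
  have := log_four_mul_div_nonneg hd hδ hδ1
  have : 0 ≤ specNorm (invSqrt (empCov lam φ D)) := norm_nonneg _
  unfold zeta
  positivity

lemma zeta_mono (h₁ : 0 ≤ C₁) (h₂ : 0 ≤ C₂) (h₃ : 0 ≤ C₃) (h₄ : 0 ≤ C₄) (hφψ : IsPrefix φ ψ)
    (hd : 0 < d) (hδ : 0 < δ) (hδ1 : δ ≤ 1) {lam : ℝ} (hlam : 0 < lam) (hn : 0 < n)
    (D : Dataset 𝒳 𝒜 n) : zeta C₁ C₂ C₃ C₄ lam φ D δ ≤ zeta C₁ C₂ C₃ C₄ lam ψ D δ := by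
  have hde : (d : ℝ) ≤ e := by exact_mod_cast hφψ.1
  have hd' : (0 : ℝ) < d := by exact_mod_cast hd
  have hL := log_four_mul_div_nonneg hd hδ hδ1
  have hLL : Real.log (4 * d / δ) ≤ Real.log (4 * e / δ) := by gcongr
  have hs0 : 0 ≤ specNorm (invSqrt (empCov lam φ D)) := norm_nonneg _
  have hs := specNorm_invSqrt_empCov_mono hφψ hlam hn D
  have hs1 := hs0.trans hs
  unfold zeta
  gcongr

/-- The terms `C₂ d + C₄ log (4 d / δ)` of `ζ` alone dominate the estimation error. -/
lemma sqrt_add_sqrt_le_zeta (h₁ : 0 ≤ C₁) (h₂ : errorConst ≤ C₂) (h₃ : 0 ≤ C₃)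
    (h₄ : errorConst ≤ C₄) (hd : 0 < d) (hδ : 0 < δ) (hδ1 : δ ≤ 1) (D : Dataset 𝒳 𝒜 n) :
    √(1 / n) + √(errorConst * (d + Real.log (4 * d / δ)) / n) ≤ zeta C₁ C₂ C₃ C₄ 1 φ D δ := by
  have hd' : (1 : ℝ) ≤ d := by exact_mod_cast hd
  have hL := log_four_mul_div_nonneg hd hδ hδ1
  have hs : 0 ≤ specNorm (invSqrt (empCov 1 φ D)) := norm_nonneg _
  have t1 : √(1 / (n : ℝ)) ≤ √(1 * d / n) := by
    rw [one_mul]; gcongr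
  have t2 : 0 ≤ C₁ * √(d / n) * specNorm (invSqrt (empCov 1 φ D)) * Real.log (4 * d / δ) := by
    positivity
  have t3 : √(errorConst * (d + Real.log (4 * d / δ)) / n) ≤
      √((C₂ * d + C₃ * √d * √(Real.log (4 * d / δ)) + C₄ * Real.log (4 * d / δ)) / n) := by
    have a1 : errorConst * d ≤ C₂ * d := by gcongr
    have a2 : errorConst * Real.log (4 * d / δ) ≤ C₄ * Real.log (4 * d / δ) := by gcongr
    have a3 : 0 ≤ C₃ * √d * √(Real.log (4 * d / δ)) := by positivity
    gcongr
    linarith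
  unfold zeta
  linarith

end Zeta

end Value

/-! ### Selection among the classes -/

section Selection

/-- Analysis of the interval intersection rule, for estimates `v̂ₖ` of `v` with increasing
deviations `ξₖ` and decreasing biases `εₖ`. If the selected index `s` is at most `k`, the intervals
of `s` and `k` meet. Otherwise the interval of `s - 1` misses one of some `j ≥ s`, which forces
`ξₛ ≤ ξⱼ ≤ 2 εₖ`. -/
lemma abs_selected_sub_le {M : ℕ} {vhat ξ ε : Fin M → ℝ} {v : ℝ} (hξ0 : ∀ k, 0 ≤ ξ k)
    (hξ : Monotone ξ) (hε0 : ∀ k, 0 ≤ ε k) (hε : Antitone ε)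
    (hv : ∀ k, |vhat k - v| ≤ ξ k + ε k) {s : Fin M}
    (hs : IsLeast {k : Fin M |
      (⋂ j ∈ Set.Ici k, Set.Icc (vhat j - 2 * ξ j) (vhat j + 2 * ξ j)).Nonempty} s)
    (k : Fin M) : |vhat s - v| ≤ 5 * ξ k + 3 * ε k := by
  obtain ⟨p, hp⟩ := hs.1
  simp only [Set.mem_iInter, Set.mem_Ici, Set.mem_Icc] at hp
  rcases le_or_gt s k with hsk | hks
  · have h1 := hp s le_rfl
    have h2 := hp k hsk
    have h3 := hξ hsk
    have h4 := abs_le.1 (hv k)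
    have := hξ0 k
    have := hε0 k
    rw [abs_le]
    constructor <;> linarith
  · obtain ⟨i, hi⟩ : ∃ i : Fin M, i.val + 1 = s.val :=
      ⟨⟨s.val - 1, by omega⟩, by have := Fin.lt_def.1 hks; dsimp only; omega⟩
    have his : i < s := Fin.lt_def.2 (by omega)
    have hki : k ≤ i := Fin.le_def.2 (by have := Fin.lt_def.1 hks; omega)
    obtain ⟨j, hsj, hj⟩ : ∃ j, s ≤ j ∧ (vhat j + 2 * ξ j < vhat i - 2 * ξ i ∨
        vhat i + 2 * ξ i < vhat j - 2 * ξ j) := by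
      by_contra! hcon
      -- otherwise the projection of `p` to the interval of `i` lies in all later intervals
      have hmem : (⋂ j ∈ Set.Ici i,
          Set.Icc (vhat j - 2 * ξ j) (vhat j + 2 * ξ j)).Nonempty := by
        refine ⟨max (vhat i - 2 * ξ i) (min p (vhat i + 2 * ξ i)), ?_⟩
        simp only [Set.mem_iInter, Set.mem_Ici, Set.mem_Icc]
        intro j hij
        rcases hij.eq_or_lt with rfl | hij
        · refine ⟨le_max_left _ _, max_le ?_ (min_le_right _ _)⟩
          linarith [hξ0 i]
        · have hsj : s ≤ j := Fin.le_def.2 (by have := Fin.lt_def.1 hij; omega)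
          obtain ⟨h1, h2⟩ := hp j hsj
          obtain ⟨h3, h4⟩ := hcon j hsj
          exact ⟨le_max_of_le_right (le_min h1 h4), max_le h3 (min_le_of_left_le h2)⟩
      exact his.not_ge (hs.2 hmem)
    have h1 := abs_le.1 (hv i)
    have h2 := abs_le.1 (hv j)
    have h3 := hε hki
    have h4 := hε (hks.le.trans hsj)
    have h5 := hε hks.le
    have h6 := hξ hsj
    have h7 : ξ i + ξ j ≤ 2 * ε k := by
      rcases hj with hj | hj <;> linarith
    have := hξ0 i
    have := hξ0 k
    exact (hv s).trans (by linarith)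

variable {𝒳 𝒜 : Type*} [MeasurableSpace 𝒳] [MeasurableSpace 𝒜] [MeasurableSingletonClass 𝒜]
  [Fintype 𝒜] [Nonempty 𝒜] {B : Bandit 𝒳 𝒜} {M n : ℕ}

lemma exists_policy_argmax {g : 𝒳 → 𝒜 → ℝ} (hg : ∀ a, Measurable fun x => g x a) :
    ∃ π : Policy 𝒳 𝒜, ∀ x a, g x a ≤ g x (π.1 x) := by
  classical
  have hunc : Measurable fun z : 𝒳 × 𝒜 => g z.1 z.2 := measurable_from_prod_countable_left hg
  have key : ∀ S : Finset 𝒜, ∃ π : Policy 𝒳 𝒜, ∀ x, ∀ a ∈ S, g x a ≤ g x (π.1 x) := by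
    intro S
    induction S using Finset.induction_on with
    | empty => exact ⟨⟨fun _ => Classical.arbitrary 𝒜, measurable_const⟩, by simp⟩
    | insert b S _ ih =>
      obtain ⟨π, hπ⟩ := ih
      have hm : Measurable fun x => g x (π.1 x) := hunc.comp π.measurable_graph
      refine ⟨⟨fun x => if g x (π.1 x) ≤ g x b then b else π.1 x,
        Measurable.ite (measurableSet_le hm (hg b)) measurable_const π.2⟩, fun x a ha => ?_⟩
      dsimp only
      split_ifs with h
      · rcases Finset.mem_insert.1 ha with rfl | ha
        · exact le_rfl
        · exact (hπ x a ha).trans h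
      · rcases Finset.mem_insert.1 ha with rfl | ha
        · exact (not_le.1 h).le
        · exact hπ x a ha
  obtain ⟨π, hπ⟩ := key Finset.univ
  exact ⟨π, fun x a => hπ x a (Finset.mem_univ a)⟩

lemma Bandit.exists_isSlopeOutput (F : ModelClasses 𝒳 𝒜 M) (hM : 0 < M)
    (hF : ∀ k a, Measurable (fun x => F.feature k x a)) {C₁ C₂ C₃ C₄ lam δ : ℝ}
    (D : Dataset 𝒳 𝒜 n) (hξ : ∀ k, 0 ≤ B.xi F C₁ C₂ C₃ C₄ lam δ D k) :
    ∃ πhat, B.IsSlopeOutput F C₁ C₂ C₃ C₄ lam δ D πhat := by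
  have : Nonempty (Fin M) := ⟨⟨0, hM⟩⟩
  choose greedy hgreedy using fun k => exists_policy_argmax (g := fitted lam (F.feature k) D)
    (fun a => by have := hF k a; unfold fitted; fun_prop)
  have hsel : ∀ l, ∃ s, IsLeast {k : Fin M |
      (⋂ j ∈ Set.Ici k, B.interval F C₁ C₂ C₃ C₄ lam δ D (greedy l) j).Nonempty} s := by
    intro l
    obtain ⟨s, hs, hmin⟩ := WellFounded.has_min wellFounded_lt {k : Fin M |
      (⋂ j ∈ Set.Ici k, B.interval F C₁ C₂ C₃ C₄ lam δ D (greedy l) j).Nonempty} (by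
        obtain ⟨m, hm⟩ : ∃ m : Fin M, ∀ j, j ≤ m :=
          ⟨⟨M - 1, by omega⟩, fun j => Fin.le_def.2 (Nat.le_sub_one_of_lt j.2)⟩
        refine ⟨m, B.valueEst lam (F.feature m) D (greedy l), ?_⟩
        simp only [Set.mem_iInter, Set.mem_Ici]
        intro j hj
        obtain rfl := le_antisymm hj (hm j)
        have := hξ m
        exact ⟨by linarith, by linarith⟩)
    exact ⟨s, hs, fun k hk => not_lt.1 (hmin k hk)⟩
  choose sel hsel using hsel
  obtain ⟨khat, hkhat⟩ := Finite.exists_max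
    fun l => B.valueEst lam (F.feature (sel l)) D (greedy l)
  exact ⟨greedy khat, greedy, sel, khat, hgreedy, hsel, hkhat, rfl⟩

lemma ModelClasses.Nested.isPrefix {F : ModelClasses 𝒳 𝒜 M} (hF : F.Nested) {k l : Fin M}
    (hkl : k ≤ l) : IsPrefix (F.feature k) (F.feature l) := by
  obtain ⟨l, hl⟩ := l
  induction l with
  | zero =>
    obtain rfl : k = ⟨0, hl⟩ := by ext; simpa using Fin.le_def.1 hkl
    exact ⟨le_rfl, fun x a => rfl⟩
  | succ l ih =>
    rcases hkl.eq_or_lt with rfl | hlt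
    · exact ⟨le_rfl, fun x a => rfl⟩
    · obtain ⟨h1, e1⟩ := ih (by omega) (Fin.le_def.2 (Nat.lt_succ_iff.1 (Fin.lt_def.1 hlt)))
      obtain ⟨h2, e2⟩ := hF ⟨l, by omega⟩ ⟨l + 1, hl⟩ rfl
      refine ⟨h1.trans h2, fun x a => ?_⟩
      rw [← e1 x a]
      ext i
      exact e2 x a (Fin.castLE h1 i)

/-- Deterministic part: if every class estimates the value of every policy up to deviation `ξₖ` and
bias `ε̃ₖ / 2`, then the selected policy competes with every policy at every `k`. -/
lemma Bandit.regret_le_of_isSlopeOutput {μ : Kernel 𝒳 𝒜} [IsMarkovKernel μ] (hreg : B.Regular)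
    (hC : concentrability μ ≠ ∞) {F : ModelClasses 𝒳 𝒜 M}
    (hF : ∀ k a, Measurable (fun x => F.feature k x a))
    (hwc : ∀ k, B.WellConditioned μ (F.feature k)) {C₁ C₂ C₃ C₄ δ : ℝ} (D : Dataset 𝒳 𝒜 n)
    (hξ0 : ∀ k, 0 ≤ B.xi F C₁ C₂ C₃ C₄ 1 δ D k) (hξ : Monotone (B.xi F C₁ C₂ C₃ C₄ 1 δ D))
    (hε : Antitone fun k => B.approxError μ (F.feature k))
    (hv : ∀ k (π : Policy 𝒳 𝒜), |B.valueEst 1 (F.feature k) D π - B.value π| ≤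
      B.xi F C₁ C₂ C₃ C₄ 1 δ D k + B.approxError μ (F.feature k) / 2)
    {πhat : Policy 𝒳 𝒜} (hout : B.IsSlopeOutput F C₁ C₂ C₃ C₄ 1 δ D πhat) (π : Policy 𝒳 𝒜)
    (k : Fin M) : B.regret π πhat ≤
      12 * (B.approxError μ (F.feature k) + B.xi F C₁ C₂ C₃ C₄ 1 δ D k) := by
  obtain ⟨greedy, sel, khat, hgreedy, hsel, hkhat, rfl⟩ := hout
  have hε0 : ∀ k, 0 ≤ B.approxError μ (F.feature k) / 2 := fun k => by
    rw [B.approxError_eq (hF k) (hwc k) hreg]; positivity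
  have hsel' : ∀ l, |B.valueEst 1 (F.feature (sel l)) D (greedy l) - B.value (greedy l)| ≤
      5 * B.xi F C₁ C₂ C₃ C₄ 1 δ D k + 3 * (B.approxError μ (F.feature k) / 2) := fun l =>
    abs_selected_sub_le (vhat := fun j => B.valueEst 1 (F.feature j) D (greedy l)) hξ0 hξ hε0
      (fun i j hij => by have := hε hij; dsimp only at this ⊢; linarith)
      (fun j => hv j (greedy l)) (hsel l) k
  have h1 := abs_le.1 (hsel' khat)
  have h2 := abs_le.1 (hsel' k)
  have h3 := hkhat k
  have h4 := B.valueEst_le_of_greedy hC (hF k) (hwc k) D 1 (hgreedy k) π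
  have h5 := abs_le.1 (hv k π)
  have h6 := abs_le.1 (hv k (greedy k))
  rw [B.regret_eq hreg]
  linarith [hε0 k]

end Selection

end BatchBandit

theorem theorem4 :
    ∃ C₀ : ℝ, 0 < C₀ ∧ ∀ C₁ C₂ C₃ C₄ : ℝ, C₀ ≤ C₁ → C₀ ≤ C₂ → C₀ ≤ C₃ → C₀ ≤ C₄ →
    ∀ (𝒳 : Type*) (𝒜 : Type*) [MeasurableSpace 𝒳] [Fintype 𝒜] [Nonempty 𝒜]
      [MeasurableSpace 𝒜] [MeasurableSingletonClass 𝒜]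
      (B : Bandit 𝒳 𝒜) (μ : Kernel 𝒳 𝒜) [IsMarkovKernel μ]
      (M n : ℕ) (F : ModelClasses 𝒳 𝒜 M) (δ : ℝ),
      0 < M → 0 < n → 0 < δ → δ ≤ 1 / Real.exp 1 →
      B.Regular →
      concentrability μ ≠ ∞ →
      F.Nested →
      (∀ k, 0 < F.dim k) →
      (∀ k a, Measurable (fun x => F.feature k x a)) →
      (∀ k, B.WellConditioned μ (F.feature k)) →
      (∀ k, B.BoundedNorm μ (F.feature k)) →
      (∀ D : Dataset 𝒳 𝒜 n, ∃ πhat, B.IsSlopeOutput F C₁ C₂ C₃ C₄ 1 δ D πhat) ∧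
      B.dataLaw μ n
        {D : Dataset 𝒳 𝒜 n | ¬ ∀ πhat, B.IsSlopeOutput F C₁ C₂ C₃ C₄ 1 δ D πhat →
          ∀ π : Policy 𝒳 𝒜,
            B.regret π πhat ≤
              12 * ⨅ k : Fin M, (B.approxError μ (F.feature k) +
                zeta C₁ C₂ C₃ C₄ 1 (F.feature k) D (δ / M) * B.coverage 1 (F.feature k) D)}
        ≤ ENNReal.ofReal (4 * δ) := by
  have hK : 0 < errorConst := by unfold errorConst; norm_num
  refine ⟨errorConst, hK, ?_⟩
  intro C₁ C₂ C₃ C₄ h₁ h₂ h₃ h₄ 𝒳 𝒜 _ _ _ _ _ B μ _ M n F δ hM hn hδ hδe hreg hC hnest hdim hF hwc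
    hbn
  have : Nonempty (Fin M) := ⟨⟨0, hM⟩⟩
  have hM' : (1 : ℝ) ≤ M := by exact_mod_cast hM
  have hδM : 0 < δ / M := by positivity
  have hδM1 : δ / M ≤ 1 := by
    have h1 : 1 / Real.exp 1 ≤ 1 := by
      rw [div_le_one (Real.exp_pos 1)]; exact Real.one_le_exp zero_le_one
    rw [div_le_one (by positivity)]
    linarith
  have hξ0 : ∀ (D : Dataset 𝒳 𝒜 n) k, 0 ≤ B.xi F C₁ C₂ C₃ C₄ 1 δ D k := fun D k =>
    mul_nonneg (zeta_nonneg (by linarith) (hdim k) hδM hδM1 1 D) (B.coverage_nonneg 1 D)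
  refine ⟨fun D => B.exists_isSlopeOutput F hM hF D (hξ0 D), ?_⟩
  have hξ : ∀ D : Dataset 𝒳 𝒜 n, Monotone (B.xi F C₁ C₂ C₃ C₄ 1 δ D) := fun D k l hkl =>
    mul_le_mul (zeta_mono (by linarith) (by linarith) (by linarith) (by linarith)
      (hnest.isPrefix hkl) (hdim k) hδM hδM1 one_pos hn D)
      (B.coverage_mono hC (hnest.isPrefix hkl) (hF l) (hwc l) hn one_pos D)
      (B.coverage_nonneg 1 D) (zeta_nonneg (by linarith) (hdim l) hδM hδM1 1 D)
  have hε : Antitone fun k => B.approxError μ (F.feature k) := fun k l hkl =>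
    B.approxError_anti (hnest.isPrefix hkl) (hF k) (hwc k) (hF l) (hwc l) hreg
  let L : Fin M → ℝ := fun k => Real.log (4 * F.dim k / (δ / M))
  have hL : ∀ k, 0 ≤ L k := fun k => log_four_mul_div_nonneg (hdim k) hδM hδM1
  -- the event on which the self-normalised bound fails for the class `k`
  let bad : Fin M → Set (Dataset 𝒳 𝒜 n) := fun k =>
    {D | ¬ ∀ w : EuclideanSpace ℝ (Fin (F.dim k)),
      (∑ i, inner ℝ (F.feature k (D i).1 (D i).2.1) w *
        ((D i).2.2 - inner ℝ (F.feature k (D i).1 (D i).2.1) (B.bestFit μ (F.feature k)))) ^ 2 ≤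
      errorConst * (F.dim k + L k) * ∑ i, inner ℝ (F.feature k (D i).1 (D i).2.1) w ^ 2}
  have hbad : ∀ k, B.dataLaw μ n (bad k) ≤ ENNReal.ofReal (δ / M) := by
    intro k
    refine (B.dataLaw_not_selfNormalised_le n (hF k) (hwc k) hreg (hL k)).trans ?_
    have hd : (1 : ℝ) ≤ F.dim k := by exact_mod_cast hdim k
    rw [show (4 : ℝ≥0∞) = ENNReal.ofReal 4 by simp, ← ENNReal.ofReal_mul (by norm_num),
      Real.exp_neg, Real.exp_log (by positivity)]
    refine ENNReal.ofReal_le_ofReal ?_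
    rw [inv_div, mul_div_assoc', mul_div_mul_left _ _ four_ne_zero]
    exact div_le_self hδM.le hd
  calc _ ≤ B.dataLaw μ n (⋃ k, bad k) := by
        refine measure_mono fun D hfail => ?_
        by_contra hD
        simp only [Set.mem_iUnion, not_exists, Set.mem_ofPred_eq, not_not, bad] at hD
        refine hfail fun πhat hout π => ?_
        rw [Real.mul_iInf_of_nonneg (by norm_num)]
        refine le_ciInf fun k => ?_
        refine B.regret_le_of_isSlopeOutput hreg hC hF hwc D (hξ0 D) (hξ D) hε (fun k π => ?_)
          hout π k
        have hθ : ‖B.bestFit μ (F.feature k)‖ ≤ 1 :=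
          hbn k _ (B.meanSqError_bestFit_le (hF k) (hwc k) hreg)
        have hG0 : 0 ≤ errorConst * (F.dim k + L k) := by have := hL k; positivity
        exact B.abs_valueEst_sub_value_le hC (hF k) (hwc k) hreg hn D
          ((sqrt_ridge_error_le hn (F.feature k) D _ hθ (hD k) hG0).trans
            (sqrt_add_sqrt_le_zeta (by linarith) h₂ (by linarith) h₄ (hdim k) hδM hδM1 D)) π
    _ ≤ ∑ k, B.dataLaw μ n (bad k) := measure_iUnion_fintype_le _ _
    _ ≤ ∑ _k : Fin M, ENNReal.ofReal (δ / M) := Finset.sum_le_sum fun k _ => hbad k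
    _ ≤ ENNReal.ofReal (4 * δ) := by
        rw [Finset.sum_const, Finset.card_univ, Fintype.card_fin, nsmul_eq_mul,
          ← ENNReal.ofReal_natCast, ← ENNReal.ofReal_mul (by positivity),
          mul_div_cancel₀ _ (by positivity)]
        exact ENNReal.ofReal_le_ofReal (by linarith)
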